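/- Notation. Let $X$ be an integer-valued random variable with probability mass function $p(j)=\Pr(X=j)$, $j\in\mathbb Z$, and support $S=S(X)=\{j\in\mathbb Z:p(j)>0\}$; put $M=|S|-1\in\{0,1,\dots\}\cup\{\infty\}$. We write $X\sim \mathrm{CO}(\mu;\delta,\beta,\gamma)$ if $X$ has finite mean $\mu$ and, with $q(j)=\delta j^2+\beta j+\gamma$ (where $\delta,\beta,\gamma\in\mathbb R$, possibly zero), $$\sum_{k\le j}(\mu-k)p(k)=q(j)p(j)\qquad\text{for all } j\in\mathbb Z .$$ Write $f^{[k]}(x)=f(x)f(x+1)\cdots f(x+k-1)$ with $f^{[0]}=1$, $(x)_k=x(x-1)\cdots(x-k+1)$ with $(x)_0=1$, $\Delta f(j)=f(j+1)-f(j)$, $\Delta^k=\Delta(\Delta^{k-1})$, $\Delta^0=I$. Let $\mathcal H^{m,n}(X)$ be the class of functions $g:S\to\mathbb R$ with $$\mathbb E\, q^{[n]}(X)\big(\Delta^n g(X)\big)^2<\infty\quad\text{and}\quad \mathbb E\, q^{[m]}(X)\,|\Delta^m g(X)|<\infty .$$ (If $j\in S$ and $j+k\notin S$ for some $0\le k\le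 i$, then $q^{[i]}(j)=0$, so the way $g$ is extended outside $S$ is irrelevant.) Theorem. Let $X\sim\mathrm{CO}(\mu;\delta,\beta,\gamma)$, and suppose that $\delta\le 0$ or $S$ is finite. Let $m\ge 0$ and $n\ge 1$ be integers with $m+n\le M$, and let $g\in\mathcal H^{m,n}(X)$. Consider $$S_{m,n}(g)=\sum_{i=1}^{m}\kappa_i\,\Big(\mathbb E\, q^{[i]}(X)\Delta^i g(X)\Big)^2+\sum_{i=1}^{n}(-1)^{i-1}\nu_i\,\mathbb E\, q^{[i]}(X)\big(\Delta^i g(X)\big)^2,$$ where $$\kappa_i=\frac{\binom{m}{i}\prod_{j=m+i}^{m+n+i-1}(1-j\delta)}{(m+n)_i\;\mathbb E\, q^{[i]}(X)\,\Big[\prod_{j=i-1}^{2i-2}(1-j\delta)\Big]\prod_{j=m}^{m+n-1}(1-j\delta)},\qquad \nu_i=\frac{\binom{n}{i}}{(m+n)_i\prod_{j=m}^{m+i-1}(1-j\delta)},$$ and an empty sum (when $m=0$) is zero. Then $\mathbb E\, g(X)^2$ and all the expectations appearing in $S_{m,n}(g)$ and in the $\kappa_i$ are finite, the constants $\kappa_i$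 ($1\le i\le m$) and $\nu_i$ ($1\le i\le n$) are strictly positive, and $$(-1)^n\big[\operatorname{Var} g(X)-S_{m,n}(g)\big]\ge 0 .$$ Moreover, $S_{m,n}(g)=\operatorname{Var} g(X)$ if and only if $g$ coincides on $S$ with a polynomial of degree at most $m+n$. -/

import Mathlib

open MeasureTheory

noncomputable section

namespace CumOrd

/-- The probability mass function `p(j) = Pr(X = j)` of an integer-valued random variable. -/
def pmf {Ω : Type*} [MeasurableSpace Ω] (P : Measure Ω) (X : Ω → ℤ) (j : ℤ) : ℝ :=
  P.real (X ⁻¹' {j})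

/-- The support `S(X) = {j : Pr(X = j) > 0}`. -/
def support {Ω : Type*} [MeasurableSpace Ω] (P : Measure Ω) (X : Ω → ℤ) : Set ℤ :=
  {j | 0 < pmf P X j}

/-- `M(X) = |S(X)| - 1`, a natural number or `∞`. -/
def bigM {Ω : Type*} [MeasurableSpace Ω] (P : Measure Ω) (X : Ω → ℤ) : ℕ∞ :=
  (support P X).encard - 1

/-- The function `q(j) = δ j² + β j + γ` on the integers. -/
def quad (δ β γ : ℝ) (j : ℤ) : ℝ :=
  δ * (j : ℝ) ^ 2 + β * (j : ℝ) + γ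

/-- The ascending power `f^{[k]}(j) = f(j) f(j+1) ⋯ f(j+k-1)`, with `f^{[0]} = 1`. -/
def ascPow (f : ℤ → ℝ) (k : ℕ) (j : ℤ) : ℝ :=
  ∏ i ∈ Finset.range k, f (j + (i : ℤ))

/-- The `k`-th order forward difference `Δ^k g`, where `Δ g(j) = g(j+1) - g(j)`. -/
def diff (k : ℕ) (g : ℤ → ℝ) : ℤ → ℝ :=
  (fwdDiff (1 : ℤ))^[k] g

/-- `X ∼ CO(μ; δ, β, γ)`: the integer-valued random variable `X` has finite mean `μ`, and
`∑_{k ≤ j} (μ - k) p(k) = q(j) p(j)` for every integer `j`, where `q(j) = δ j² + β j + γ`. -/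
structure IsCO {Ω : Type*} [MeasurableSpace Ω] (P : Measure Ω) (X : Ω → ℤ)
    (μ δ β γ : ℝ) : Prop where
  measurable : Measurable X
  integrable : Integrable (fun ω => (X ω : ℝ)) P
  mean_eq : ∫ ω, (X ω : ℝ) ∂P = μ
  sum_eq : ∀ j : ℤ,
    ∑' k : Set.Iic j, (μ - ((k : ℤ) : ℝ)) * pmf P X (k : ℤ) = quad δ β γ j * pmf P X j

/-- `X ∼ CO(μ; δ, β, γ)` belongs to the class `𝒞`: `δ ≤ 0` or the support is finite. -/
def InClassC {Ω : Type*} [MeasurableSpace Ω] (P : Measure Ω) (X : Ω → ℤ)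
    (μ δ β γ : ℝ) : Prop :=
  IsCO P X μ δ β γ ∧ (δ ≤ 0 ∨ (support P X).Finite)

/-- `g ∈ ℋ^{m,n}(X)`: `E q^{[n]}(X) (Δ^n g(X))² < ∞` and `E q^{[m]}(X) |Δ^m g(X)| < ∞`. -/
def MemH {Ω : Type*} [MeasurableSpace Ω] (P : Measure Ω) (X : Ω → ℤ)
    (δ β γ : ℝ) (m n : ℕ) (g : ℤ → ℝ) : Prop :=
  Integrable (fun ω => ascPow (quad δ β γ) n (X ω) * (diff n g (X ω)) ^ 2) P ∧
  Integrable (fun ω => ascPow (quad δ β γ) m (X ω) * |diff m g (X ω)|) P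

/-- The weight `κ_i`, for `1 ≤ i ≤ m`. -/
def kappa {Ω : Type*} [MeasurableSpace Ω] (P : Measure Ω) (X : Ω → ℤ)
    (δ β γ : ℝ) (m n i : ℕ) : ℝ :=
  ((m.choose i : ℝ) * ∏ j ∈ Finset.Ico (m + i) (m + n + i), (1 - (j : ℝ) * δ)) /
    (((m + n).descFactorial i : ℝ) * (∫ ω, ascPow (quad δ β γ) i (X ω) ∂P) *
      (∏ j ∈ Finset.Ico (i - 1) (2 * i - 1), (1 - (j : ℝ) * δ)) *
      ∏ j ∈ Finset.Ico m (m + n), (1 - (j : ℝ) * δ))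

/-- The weight `ν_i`, for `1 ≤ i ≤ n`. -/
def nu (δ : ℝ) (m n i : ℕ) : ℝ :=
  (n.choose i : ℝ) /
    (((m + n).descFactorial i : ℝ) * ∏ j ∈ Finset.Ico m (m + i), (1 - (j : ℝ) * δ))

/-- The quantity `S_{m,n}(g)`. -/
def boundS {Ω : Type*} [MeasurableSpace Ω] (P : Measure Ω) (X : Ω → ℤ)
    (δ β γ : ℝ) (m n : ℕ) (g : ℤ → ℝ) : ℝ :=
  ∑ i ∈ Finset.Icc 1 m, kappa P X δ β γ m n i *
      (∫ ω, ascPow (quad δ β γ) i (X ω) * diff i g (X ω) ∂P) ^ 2 +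
    ∑ i ∈ Finset.Icc 1 n, (-1 : ℝ) ^ (i - 1) * nu δ m n i *
      ∫ ω, ascPow (quad δ β γ) i (X ω) * (diff i g (X ω)) ^ 2 ∂P

end CumOrd

end

open MeasureTheory

noncomputable section

namespace CumOrd

/-! Put λ_k = k(1 - (k-1)δ), so that `gap δ k r` is λ_k - λ_r. The cumulative identity for p is a
first-order recurrence with quadratic coefficients. Through it, the difference operator from the
weight q^{[i]}p to the weight q^{[i+1]}p has a formal adjoint `adj` that preserves polynomials and
raises degree by at most one. Iterated adjoints of the constant 1 (a Rodrigues formula) give the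
orthogonal polynomials `ordPoly i k`, and Δ carries the family at level i to multiples of the family
at level i+1.

Write b_k = E q^{[k]}Δ^k g, and let H_k = E q^{[k]} · ∏_{r<k}(λ_k - λ_r) be the squared norm of
`ordPoly 0 k`. Parseval at level i gives E q^{[i]}(Δ^i g)² = ∑_k (b_k²/H_k) ∏_{r<i}(λ_k - λ_r)
(`hasSum_diff_sq`); terms with E q^{[k]} = 0 are zero. Hence the alternating sum of these
expectations, with ν_0 = 1, is ∑_k (b_k²/H_k) R(λ_k). By Newton interpolation
(`sum_nu_mul_prod_gap`), R is the polynomial with zeros λ_{m+1}, …, λ_{m+n} and R(λ_0) = 1. The term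
k = 0 is (E g)², the terms 1 ≤ k ≤ m are the κ-sum because κ_k = R(λ_k)/H_k (`kappa_closed_form`),
and the next n terms vanish. So Var g - S is the sum over k > m+n (`hasSum_remainder`). There each
factor of R is negative, which gives the sign (-1)^n. Equality forces b_k = 0 for all k > m+n, and
by completeness this means that g is a polynomial on the support.

Two analytic facts support this. Completeness follows from exponential moments of p
(`exists_summable_mul_exp`, trivial for finite support) and analyticity of a Laplace transform
(`eq_zero_of_moments_eq_zero`). Square summability of Δ^i g for i < n follows from that of Δ^n g by
a discrete Hardy inequality, which needs 1 - 2iδ > 0; this holds because q^{[i+1]}p has positive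
mass (`one_sub_pos_of_tsum_pos`). -/

/-! ### Analytic tools: uniqueness from moments and Parseval's identity -/

open Complex in
/-- The coefficients of an absolutely summable trigonometric series with sum zero vanish. -/
theorem eq_zero_of_tsum_mul_fourier_eq_zero {c : ℤ → ℂ} (hc : Summable fun j => ‖c j‖)
    (h0 : ∀ θ : ℝ, ∑' j : ℤ, c j * exp (θ * I * j) = 0) (k : ℤ) : c k = 0 := by
  have : Fact (0 < 2 * Real.pi) := ⟨Real.two_pi_pos⟩
  have hs : Summable fun j : ℤ => c j • (fourier j : C(AddCircle (2 * Real.pi), ℂ)) := by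
    refine Summable.of_norm ?_
    simpa [norm_smul, fourier_norm] using hc
  have hz : ∑' j : ℤ, c j • (fourier j : C(AddCircle (2 * Real.pi), ℂ)) = 0 := by
    ext x
    induction x using QuotientAddGroup.induction_on with
    | H θ =>
      refine (ContinuousMap.tsum_apply hs (θ : AddCircle (2 * Real.pi))).symm.trans ?_
      refine Eq.trans ?_ (h0 θ)
      refine tsum_congr fun j => ?_
      rw [ContinuousMap.smul_apply, fourier_coe_apply, smul_eq_mul]
      congr 2
      have : (Real.pi : ℂ) ≠ 0 := by exact_mod_cast Real.pi_ne_zero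
      push_cast
      field_simp
  have h := hs.hasSum
  rw [hz] at h
  -- Pairing with the k-th Fourier character in L² isolates the k-th coefficient.
  have h2 := h.mapL (ContinuousMap.toLp (E := ℂ) 2 AddCircle.haarAddCircle ℂ)
  have h3 := h2.mapL (innerSL ℂ (fourierLp (T := 2 * Real.pi) 2 k))
  have h4 := hasSum_single (f := fun j : ℤ => (innerSL ℂ (fourierLp (T := 2 * Real.pi) 2 k))
      ((ContinuousMap.toLp (E := ℂ) 2 AddCircle.haarAddCircle ℂ)
        (c j • (fourier j : C(AddCircle (2 * Real.pi), ℂ))))) k (by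
    intro j hj
    have := (orthonormal_iff_ite.mp (orthonormal_fourier (T := 2 * Real.pi))) k j
    rw [map_smul, map_smul, innerSL_apply_apply]
    erw [this]
    simp [hj.symm])
  have h5 := h4.unique h3
  have := (orthonormal_iff_ite.mp (orthonormal_fourier (T := 2 * Real.pi))) k k
  rw [map_smul, map_smul, innerSL_apply_apply] at h5
  erw [this] at h5
  simpa using h5

open Complex in
/-- A sequence on `ℤ` with exponential decay is determined by its moments. -/
theorem eq_zero_of_moments_eq_zero {c : ℤ → ℝ} {t : ℝ} (ht : 0 < t)
    (hc : Summable fun j : ℤ => |c j| * Real.exp (t * |(j : ℝ)|))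
    (h0 : ∀ k : ℕ, ∑' j : ℤ, c j * (j : ℝ) ^ k = 0) (k : ℤ) : c k = 0 := by
  set G : ℂ → ℂ := fun z => ∑' j : ℤ, (c j : ℂ) * exp (z * j) with hG
  set U : Set ℂ := {z | |z.re| < t} with hU
  have hUo : IsOpen U := isOpen_lt (continuous_abs.comp continuous_re) continuous_const
  have hUc : Convex ℝ U := by
    have : U = Complex.re ⁻¹' (Metric.ball 0 t) := by
      ext z; simp [hU]
    rw [this]
    exact (convex_ball (0 : ℝ) t).is_linear_preimage (f := Complex.re) ⟨by simp, by simp⟩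
  have hbd : ∀ (j : ℤ) (z : ℂ), z ∈ U →
      ‖(c j : ℂ) * exp (z * j)‖ ≤ |c j| * Real.exp (t * |(j : ℝ)|) := by
    intro j z hz
    rw [norm_mul, norm_exp, norm_real, Real.norm_eq_abs]
    refine mul_le_mul_of_nonneg_left (Real.exp_le_exp.2 ?_) (abs_nonneg _)
    have : (z * (j : ℂ)).re = z.re * j := by simp
    rw [this]
    calc z.re * j ≤ |z.re * j| := le_abs_self _
      _ = |z.re| * |(j : ℝ)| := abs_mul _ _
      _ ≤ _ := mul_le_mul_of_nonneg_right (le_of_lt hz) (abs_nonneg _)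
  have hdiff : DifferentiableOn ℂ G U :=
    differentiableOn_tsum_of_summable_norm hc (fun j => by fun_prop) hUo hbd
  have han : AnalyticOnNhd ℂ G U := hdiff.analyticOnNhd hUo
  have h0U : (0 : ℂ) ∈ U := by simp [hU, ht]
  -- Near 0 the exponentials may be expanded and the two sums exchanged; each power of z then
  -- carries a vanishing moment.
  have hloc : ∀ z ∈ Metric.ball (0 : ℂ) t, G z = 0 := by
    intro z hz
    have hz' : ‖z‖ < t := by simpa using hz
    have hsum : Summable (Function.uncurry fun (j : ℤ) (n : ℕ) =>
        (c j : ℂ) * ((z * j) ^ n / (n.factorial : ℂ))) := by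
      refine Summable.of_norm ?_
      rw [summable_prod_of_nonneg (fun _ => norm_nonneg _)]
      have hn : ∀ j : ℤ, HasSum (fun n : ℕ => ‖(c j : ℂ) * ((z * j) ^ n / (n.factorial : ℂ))‖)
          (|c j| * Real.exp (‖z‖ * |(j : ℝ)|)) := by
        intro j
        have := (NormedSpace.expSeries_div_hasSum_exp (‖z‖ * |(j : ℝ)|)).mul_left (|c j|)
        rw [← Real.exp_eq_exp_ℝ] at this
        have he : (fun n : ℕ => ‖(c j : ℂ) * ((z * j) ^ n / (n.factorial : ℂ))‖) =
            fun n => |c j| * ((‖z‖ * |(j : ℝ)|) ^ n / (n.factorial : ℝ)) := by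
          ext n
          simp [mul_pow]
        rwa [he]
      refine ⟨fun j => (hn j).summable, ?_⟩
      refine Summable.of_nonneg_of_le (fun j => tsum_nonneg fun n => norm_nonneg _) (fun j => ?_) hc
      refine (hn j).tsum_eq.le.trans ?_
      refine mul_le_mul_of_nonneg_left (Real.exp_le_exp.2 ?_) (abs_nonneg _)
      exact mul_le_mul_of_nonneg_right hz'.le (abs_nonneg _)
    have h1 : G z = ∑' (j : ℤ) (n : ℕ), (c j : ℂ) * ((z * j) ^ n / (n.factorial : ℂ)) := by
      refine tsum_congr fun j => ?_
      have := (NormedSpace.expSeries_div_hasSum_exp (z * j)).mul_left (c j : ℂ)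
      rw [this.tsum_eq, Complex.exp_eq_exp_ℂ]
    rw [h1, ← hsum.tsum_comm]
    convert tsum_zero with n
    have h2 : ∀ j : ℤ, (c j : ℂ) * ((z * j) ^ n / (n.factorial : ℂ)) =
        ((c j * (j : ℝ) ^ n : ℝ) : ℂ) * (z ^ n / (n.factorial : ℂ)) := by
      intro j; push_cast; ring
    simp_rw [h2]
    rw [tsum_mul_right, ← Complex.ofReal_tsum, h0 n]
    simp
  have hev : G =ᶠ[nhds 0] 0 :=
    Filter.eventually_of_mem (Metric.ball_mem_nhds 0 ht) hloc
  have hzero := han.eqOn_zero_of_preconnected_of_eventuallyEq_zero hUc.isPreconnected h0U hev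
  have hcs : Summable fun j : ℤ => ‖(c j : ℂ)‖ := by
    refine Summable.of_nonneg_of_le (fun j => norm_nonneg _) (fun j => ?_) hc
    rw [norm_real, Real.norm_eq_abs]
    refine le_mul_of_one_le_right (abs_nonneg _) (Real.one_le_exp (by positivity))
  -- The imaginary axis lies in the strip, and there the transform is a Fourier series.
  have := eq_zero_of_tsum_mul_fourier_eq_zero hcs (fun θ => hzero (x := θ * I) (by simp [hU, ht])) k
  exact_mod_cast this

open scoped InnerProductSpace in
/-- Parseval's identity for a complete orthogonal sequence, in which zero vectors are allowed. -/
theorem hasSum_inner_sq_div {E : Type*} [NormedAddCommGroup E] [InnerProductSpace ℝ E]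
    [CompleteSpace E] (e : ℕ → E) (horth : ∀ k l, k ≠ l → ⟪e k, e l⟫_ℝ = 0)
    (hcomp : ∀ y, (∀ k, ⟪e k, y⟫_ℝ = 0) → y = 0) (x : E) :
    HasSum (fun k => ⟪e k, x⟫_ℝ ^ 2 / ‖e k‖ ^ 2) (‖x‖ ^ 2) := by
  set s : Set ℕ := {k | e k ≠ 0} with hs
  set v : s → E := fun k => (‖e k‖⁻¹ : ℝ) • e k with hv
  have hon : Orthonormal ℝ v := by
    refine ⟨fun k => ?_, fun k l hkl => ?_⟩
    · have : ‖e k‖ ≠ 0 := norm_ne_zero_iff.2 k.2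
      simp [hv, norm_smul, this]
    · simp only [hv, inner_smul_left, inner_smul_right]
      rw [horth k l (fun h => hkl (Subtype.ext h))]
      simp
  have hsp : (Submodule.span ℝ (Set.range v))ᗮ = ⊥ := by
    rw [Submodule.eq_bot_iff]
    intro y hy
    refine hcomp y fun k => ?_
    by_cases hk : e k = 0
    · simp [hk]
    have h1 := (Submodule.mem_orthogonal _ _).1 hy (v ⟨k, hk⟩) (Submodule.subset_span ⟨_, rfl⟩)
    simp only [hv, inner_smul_left] at h1
    have : ‖e k‖ ≠ 0 := norm_ne_zero_iff.2 hk
    simpa [this] using h1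
  have h := (HilbertBasis.mkOfOrthogonalEqBot hon hsp).hasSum_inner_mul_inner x x
  rw [HilbertBasis.coe_mkOfOrthogonalEqBot, real_inner_self_eq_norm_sq] at h
  have h2 : (fun k : s => ⟪x, v k⟫_ℝ * ⟪v k, x⟫_ℝ) =
      (fun k => ⟪e k, x⟫_ℝ ^ 2 / ‖e k‖ ^ 2) ∘ ((↑) : s → ℕ) := by
    ext k
    rw [real_inner_comm (v k) x]
    simp only [hv, inner_smul_left, Function.comp_apply]
    simp
    ring
  rw [h2] at h
  refine (hasSum_subtype_iff_of_support_subset ?_).1 h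
  intro k hk
  by_contra hk'
  have : e k = 0 := by simpa [hs] using hk'
  simp [this] at hk

open Polynomial in
/-- A polynomial is dominated by every exponential. -/
theorem exists_abs_eval_le_exp (V : ℝ[X]) {t : ℝ} (ht : 0 < t) :
    ∃ C, 0 ≤ C ∧ ∀ x : ℝ, |V.eval x| ≤ C * Real.exp (t * |x|) := by
  induction V using Polynomial.induction_on' with
  | add V W hV hW =>
    obtain ⟨C, hC, h1⟩ := hV
    obtain ⟨D, hD, h2⟩ := hW
    refine ⟨C + D, by positivity, fun x => ?_⟩
    rw [eval_add, add_mul]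
    exact (abs_add_le _ _).trans (add_le_add (h1 x) (h2 x))
  | monomial n a =>
    refine ⟨|a| * (n.factorial / t ^ n), by positivity, fun x => ?_⟩
    rw [eval_monomial, abs_mul, mul_assoc, abs_pow]
    refine mul_le_mul_of_nonneg_left ?_ (abs_nonneg a)
    have h := Real.pow_div_factorial_le_exp (t * |x|) (by positivity) n
    have h3 : (0 : ℝ) < n.factorial := by positivity
    rw [div_le_iff₀ h3, mul_pow] at h
    rw [div_mul_eq_mul_div, le_div_iff₀ (by positivity)]
    linarith

/-! ### The weights q^{[i]} p: recurrence, positivity and interval support -/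

/-- The properties of the probability mass function of a cumulative Ord variable with exponential
moments that the variance bounds depend on. -/
structure OrdWeight (p : ℤ → ℝ) (μ δ β γ : ℝ) : Prop where
  nonneg : ∀ j, 0 ≤ p j
  quad_mul_nonneg : ∀ j, 0 ≤ quad δ β γ j * p j
  rec_eq : ∀ j, (quad δ β γ j - μ + j) * p j = quad δ β γ (j - 1) * p (j - 1)
  exp_moment : ∃ t > 0, Summable fun j : ℤ => p j * Real.exp (t * |(j : ℝ)|)

/-- The weight `q^{[i]} p`. -/
def wt (p : ℤ → ℝ) (δ β γ : ℝ) (i : ℕ) (j : ℤ) : ℝ := ascPow (quad δ β γ) i j * p j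

variable {p : ℤ → ℝ} {μ δ β γ : ℝ}

@[simp] theorem wt_zero (j : ℤ) : wt p δ β γ 0 j = p j := by simp [wt, ascPow]

theorem wt_succ (i : ℕ) (j : ℤ) :
    wt p δ β γ (i + 1) j = quad δ β γ (j + i) * wt p δ β γ i j := by
  rw [wt, wt, ascPow, ascPow, Finset.prod_range_succ]; ring

namespace OrdWeight

/-- The recurrence trades q(j-1)p(j-1) for (q(j) - μ + j)p(j), so a shifted weight of level i+1 is
again a polynomial multiple of the weight of level i. -/
theorem wt_succ_sub_one (h : OrdWeight p μ δ β γ) (i : ℕ) (j : ℤ) :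
    wt p δ β γ (i + 1) (j - 1) = (quad δ β γ j - μ + j) * wt p δ β γ i j := by
  have h1 : ascPow (quad δ β γ) (i + 1) (j - 1) =
      quad δ β γ (j - 1) * ascPow (quad δ β γ) i j := by
    rw [ascPow, ascPow, Finset.prod_range_succ']
    rw [mul_comm]
    congr 1
    · simp
    · refine Finset.prod_congr rfl fun l _ => ?_
      congr 1; push_cast; ring
  rw [wt, wt, h1]
  linear_combination (-ascPow (quad δ β γ) i j) * h.rec_eq j

/-- If p vanished just after a point where it is positive, the recurrence would make q vanish at
that point, hence the weight too. -/
theorem pos_of_wt_ne_zero (h : OrdWeight p μ δ β γ) {i : ℕ} {j : ℤ} (hj : wt p δ β γ i j ≠ 0)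
    {l : ℕ} (hl : l ≤ i) : 0 < p (j + l) := by
  induction i generalizing l with
  | zero =>
    obtain rfl : l = 0 := by omega
    rw [wt_zero] at hj
    simpa using lt_of_le_of_ne (h.nonneg j) hj.symm
  | succ i ih =>
    rw [wt_succ] at hj
    have hw := right_ne_zero_of_mul hj
    rcases Nat.lt_or_ge l (i + 1) with h1 | h1
    · exact ih hw (by omega)
    obtain rfl : l = i + 1 := by omega
    have h2 := ih hw le_rfl
    refine lt_of_le_of_ne (h.nonneg _) fun h3 => ?_
    have h4 := h.rec_eq (j + i + 1)
    rw [Nat.cast_succ, ← add_assoc] at h3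
    rw [← h3, mul_zero, add_sub_cancel_right] at h4
    exact mul_ne_zero (left_ne_zero_of_mul hj) h2.ne' h4.symm

theorem wt_nonneg (h : OrdWeight p μ δ β γ) (i : ℕ) (j : ℤ) : 0 ≤ wt p δ β γ i j := by
  induction i with
  | zero => simpa using h.nonneg j
  | succ i ih =>
    rw [wt_succ]
    by_cases h0 : wt p δ β γ i j = 0
    · simp [h0]
    refine mul_nonneg ?_ ih
    exact nonneg_of_mul_nonneg_left (h.quad_mul_nonneg _) (h.pos_of_wt_ne_zero h0 le_rfl)

theorem quad_mul_sub (h : OrdWeight p μ δ β γ) (j : ℤ) :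
    quad δ β γ j * p j - quad δ β γ (j - 1) * p (j - 1) = (μ - j) * p j := by
  linear_combination h.rec_eq j

theorem quad_mul_mono (h : OrdWeight p μ δ β γ) {j k : ℤ} (hjk : j ≤ k) (hk : (k : ℝ) ≤ μ) :
    quad δ β γ j * p j ≤ quad δ β γ k * p k := by
  induction k, hjk using Int.leInduction with
  | base => exact le_rfl
  | succ k hjk ih =>
    push_cast at hk
    have h1 := h.quad_mul_sub (k + 1)
    rw [add_sub_cancel_right] at h1
    push_cast at h1
    have h2 : 0 ≤ (μ - (k + 1)) * p (k + 1) := mul_nonneg (by linarith) (h.nonneg _)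
    linarith [ih (by linarith)]

theorem quad_mul_anti (h : OrdWeight p μ δ β γ) {j k : ℤ} (hjk : j ≤ k) (hj : μ ≤ (j : ℝ)) :
    quad δ β γ k * p k ≤ quad δ β γ j * p j := by
  induction k, hjk using Int.leInduction with
  | base => exact le_rfl
  | succ k hjk ih =>
    have h1 := h.quad_mul_sub (k + 1)
    rw [add_sub_cancel_right] at h1
    push_cast at h1
    have h3 : (j : ℝ) ≤ k := by exact_mod_cast hjk
    have h2 : 0 ≤ (k + 1 - μ) * p (k + 1) := mul_nonneg (by linarith) (h.nonneg _)
    linarith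

/-- The product qp increases up to μ and decreases afterwards. Below μ it is compared with its value
at j, otherwise with its value at l - 1; both are positive by the recurrence. Hence the support is
an interval. -/
theorem quad_mul_pos (h : OrdWeight p μ δ β γ) {j k l : ℤ} (hj : 0 < p j) (hl : 0 < p l)
    (hjk : j ≤ k) (hkl : k < l) : 0 < quad δ β γ k * p k := by
  rcases lt_or_ge (k : ℝ) μ with h1 | h1
  · refine lt_of_lt_of_le ?_ (h.quad_mul_mono hjk h1.le)
    have h2 := h.quad_mul_sub j
    have h3 : (j : ℝ) ≤ k := by exact_mod_cast hjk
    have h4 : 0 < (μ - j) * p j := mul_pos (by linarith) hj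
    linarith [h.quad_mul_nonneg (j - 1)]
  · refine lt_of_lt_of_le ?_ (h.quad_mul_anti (Int.le_sub_one_of_lt hkl) h1)
    have h2 := h.quad_mul_sub l
    have h3 : (k : ℝ) < l := by exact_mod_cast hkl
    have h4 : 0 < (l - μ) * p l := mul_pos (by linarith) hl
    linarith [h.quad_mul_nonneg l]

theorem pos_of_mem (h : OrdWeight p μ δ β γ) {j k l : ℤ} (hj : 0 < p j) (hl : 0 < p l)
    (hjk : j ≤ k) (hkl : k ≤ l) : 0 < p k := by
  rcases hkl.eq_or_lt with rfl | hkl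
  · exact hl
  exact lt_of_le_of_ne (h.nonneg k) (right_ne_zero_of_mul (h.quad_mul_pos hj hl hjk hkl).ne').symm

theorem wt_pos (h : OrdWeight p μ δ β γ) {i : ℕ} {j : ℤ} (hj : 0 < p j) (hl : 0 < p (j + i)) :
    0 < wt p δ β γ i j := by
  refine mul_pos (Finset.prod_pos fun l hl' => ?_) hj
  have hl' := Finset.mem_range.1 hl'
  exact pos_of_mul_pos_left (h.quad_mul_pos hj hl (by omega) (by omega)) (h.nonneg _)

/-- A function whose difference vanishes on the support of `q^{[i+1]} p` is constant on the support
of `q^{[i]} p`. -/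
theorem eq_of_fwdDiff_eq_zero (h : OrdWeight p μ δ β γ) {i : ℕ} {u : ℤ → ℝ}
    (hu : ∀ j, wt p δ β γ (i + 1) j ≠ 0 → u (j + 1) = u j) {j k : ℤ}
    (hj : wt p δ β γ i j ≠ 0) (hk : wt p δ β γ i k ≠ 0) : u j = u k := by
  wlog hjk : j ≤ k generalizing j k
  · exact (this hk hj (by omega)).symm
  have hj0 := h.pos_of_wt_ne_zero hj (Nat.zero_le i)
  have hki := h.pos_of_wt_ne_zero hk le_rfl
  have key : ∀ l, j ≤ l → l ≤ k → u l = u j := by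
    intro l hjl
    induction l, hjl using Int.leInduction with
    | base => exact fun _ => rfl
    | succ l hjl ih =>
      intro hl
      rw [hu l ?_, ih (by omega)]
      refine (h.wt_pos (h.pos_of_mem hj0 hki (by simpa using hjl) (by omega))
        (h.pos_of_mem hj0 hki ?_ ?_)).ne'
      · push_cast; omega
      · push_cast; omega
  exact (key k hjk le_rfl).symm

end OrdWeight

/-! ### Polynomial moments and summation by parts -/

open Polynomial

/-- The polynomial with values `q`. -/
def quadPoly (δ β γ : ℝ) : ℝ[X] := C δ * X ^ 2 + C β * X + C γ

theorem eval_quadPoly (j : ℤ) : (quadPoly δ β γ).eval (j : ℝ) = quad δ β γ j := by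
  simp [quadPoly, quad]

theorem exists_ascPow_eq_eval (δ β γ : ℝ) (i : ℕ) :
    ∃ A : ℝ[X], ∀ j : ℤ, ascPow (quad δ β γ) i j = A.eval (j : ℝ) := by
  refine ⟨∏ l ∈ Finset.range i, (quadPoly δ β γ).comp (X + C (l : ℝ)), fun j => ?_⟩
  rw [eval_prod, ascPow]
  refine Finset.prod_congr rfl fun l _ => ?_
  rw [← eval_quadPoly]
  simp

namespace OrdWeight

/-- Half of the exponential rate absorbs the polynomial factor, so one t serves all V. -/
theorem wt_exp_moment (h : OrdWeight p μ δ β γ) (i : ℕ) :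
    ∃ t > 0, ∀ V : ℝ[X],
      Summable fun j : ℤ => |wt p δ β γ i j * V.eval (j : ℝ)| * Real.exp (t * |(j : ℝ)|) := by
  obtain ⟨t, ht, hs⟩ := h.exp_moment
  refine ⟨t / 2, by positivity, fun V => ?_⟩
  obtain ⟨A, hA⟩ := exists_ascPow_eq_eval δ β γ i
  obtain ⟨C, hC, hb⟩ := exists_abs_eval_le_exp (A * V) (half_pos ht)
  refine Summable.of_nonneg_of_le (fun j => by positivity) (fun j => ?_) (hs.mul_left C)
  have h1 : |wt p δ β γ i j * V.eval (j : ℝ)| = p j * |(A * V).eval (j : ℝ)| := by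
    rw [wt, hA, eval_mul, mul_comm _ (p j), mul_assoc, abs_mul, abs_of_nonneg (h.nonneg j)]
  rw [h1]
  have h2 : Real.exp (t * |(j : ℝ)|) =
      Real.exp (t / 2 * |(j : ℝ)|) * Real.exp (t / 2 * |(j : ℝ)|) := by
    rw [← Real.exp_add]; congr 1; ring
  rw [h2]
  calc p j * |(A * V).eval (j : ℝ)| * Real.exp (t / 2 * |(j : ℝ)|)
      ≤ p j * (C * Real.exp (t / 2 * |(j : ℝ)|)) * Real.exp (t / 2 * |(j : ℝ)|) := by
        gcongr
        · exact h.nonneg j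
        · exact hb _
    _ = _ := by ring

theorem summable_wt_eval (h : OrdWeight p μ δ β γ) (i : ℕ) (V : ℝ[X]) :
    Summable fun j : ℤ => wt p δ β γ i j * V.eval (j : ℝ) := by
  obtain ⟨t, ht, hs⟩ := h.wt_exp_moment i
  refine Summable.of_norm_bounded (hs V) fun j => ?_
  rw [Real.norm_eq_abs]
  exact le_mul_of_one_le_right (abs_nonneg _) (Real.one_le_exp (by positivity))

end OrdWeight

/-- `u` times every polynomial is summable against the weight `w`. -/
def Mod (w u : ℤ → ℝ) : Prop := ∀ V : ℝ[X], Summable fun j : ℤ => w j * (u j * V.eval (j : ℝ))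

theorem Mod.sub {w u v : ℤ → ℝ} (hu : Mod w u) (hv : Mod w v) : Mod w fun j => u j - v j := by
  intro V
  refine ((hu V).sub (hv V)).congr fun j => ?_
  ring

theorem Mod.summable {w u : ℤ → ℝ} (hu : Mod w u) : Summable fun j => w j * u j := by
  simpa using hu 1

theorem Mod.succ {i : ℕ} {u : ℤ → ℝ} (hu : Mod (wt p δ β γ i) u) :
    Mod (wt p δ β γ (i + 1)) u := by
  intro V
  refine (hu ((quadPoly δ β γ).comp (X + C (i : ℝ)) * V)).congr fun j => ?_
  rw [wt_succ, ← eval_quadPoly]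
  simp; ring

/-- The formal adjoint `v ↦ σ v(· - 1) - q(· + i) v` of the difference operator from the weight
`q^{[i]} p` to the weight `q^{[i+1]} p`. -/
def adj (μ δ β γ : ℝ) (i : ℕ) (V : ℝ[X]) : ℝ[X] :=
  (quadPoly δ β γ - C μ + X) * V.comp (X - C 1) - (quadPoly δ β γ).comp (X + C (i : ℝ)) * V

theorem eval_adj (i : ℕ) (V : ℝ[X]) (j : ℤ) :
    (adj μ δ β γ i V).eval (j : ℝ) = (quad δ β γ j - μ + j) * V.eval ((j : ℝ) - 1) -
      quad δ β γ (j + i) * V.eval (j : ℝ) := by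
  rw [← eval_quadPoly, ← eval_quadPoly]
  simp [adj]

namespace OrdWeight

theorem mod_eval (h : OrdWeight p μ δ β γ) (i : ℕ) (W : ℝ[X]) :
    Mod (wt p δ β γ i) fun j => W.eval (j : ℝ) := by
  intro V
  refine (h.summable_wt_eval i (W * V)).congr fun j => ?_
  rw [eval_mul]

theorem mod_of_sq (h : OrdWeight p μ δ β γ) {i : ℕ} {u : ℤ → ℝ}
    (hu : Summable fun j => wt p δ β γ i j * u j ^ 2) : Mod (wt p δ β γ i) u := by
  intro V
  refine Summable.of_norm_bounded (hu.add (h.summable_wt_eval i (V ^ 2))) fun j => ?_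
  rw [Real.norm_eq_abs, abs_mul, abs_of_nonneg (h.wt_nonneg i j), ← mul_add]
  refine mul_le_mul_of_nonneg_left ?_ (h.wt_nonneg i j)
  rw [eval_pow, abs_le]
  constructor <;> nlinarith [sq_nonneg (u j - V.eval (j : ℝ)), sq_nonneg (u j + V.eval (j : ℝ))]

theorem mod_succ_shift (h : OrdWeight p μ δ β γ) {i : ℕ} {u : ℤ → ℝ}
    (hu : Mod (wt p δ β γ i) u) : Mod (wt p δ β γ (i + 1)) fun j => u (j + 1) := by
  intro V
  rw [← (Equiv.subRight (1 : ℤ)).summable_iff]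
  refine (hu ((quadPoly δ β γ - C μ + X) * V.comp (X - C 1))).congr fun j => ?_
  simp only [Function.comp_apply, Equiv.subRight_apply]
  rw [h.wt_succ_sub_one, ← eval_quadPoly]
  simp; ring

theorem mod_fwdDiff (h : OrdWeight p μ δ β γ) {i : ℕ} {u : ℤ → ℝ}
    (hu : Mod (wt p δ β γ i) u) : Mod (wt p δ β γ (i + 1)) (fwdDiff 1 u) :=
  (h.mod_succ_shift hu).sub (hu.succ)

/-- Summation by parts. -/
theorem tsum_mul_adj (h : OrdWeight p μ δ β γ) {i : ℕ} {u : ℤ → ℝ}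
    (hu : Mod (wt p δ β γ i) u) (V : ℝ[X]) :
    ∑' j : ℤ, wt p δ β γ i j * (u j * (adj μ δ β γ i V).eval (j : ℝ)) =
      ∑' j : ℤ, wt p δ β γ (i + 1) j * (fwdDiff 1 u j * V.eval (j : ℝ)) := by
  have h1 := h.mod_succ_shift hu V
  have h2 := hu.succ V
  have h3 : ∀ j : ℤ, wt p δ β γ (i + 1) (j - 1) * (u j * V.eval ((j : ℝ) - 1)) -
      wt p δ β γ (i + 1) j * (u j * V.eval (j : ℝ)) =
      wt p δ β γ i j * (u j * (adj μ δ β γ i V).eval (j : ℝ)) := by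
    intro j
    rw [eval_adj, h.wt_succ_sub_one, wt_succ]; ring
  have h4 : Summable fun j : ℤ => wt p δ β γ (i + 1) (j - 1) * (u j * V.eval ((j : ℝ) - 1)) := by
    rw [← (Equiv.addRight (1 : ℤ)).summable_iff]
    refine h1.congr fun j => ?_
    simp
  have h5 : ∑' j : ℤ, wt p δ β γ (i + 1) (j - 1) * (u j * V.eval ((j : ℝ) - 1)) =
      ∑' j : ℤ, wt p δ β γ (i + 1) j * (u (j + 1) * V.eval (j : ℝ)) := by
    rw [← (Equiv.addRight (1 : ℤ)).tsum_eq]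
    refine tsum_congr fun j => ?_
    simp
  rw [← tsum_congr h3, h4.tsum_sub h2, h5, ← h1.tsum_sub h2]
  refine tsum_congr fun j => ?_
  simp only [fwdDiff]; ring

end OrdWeight

/-! ### Hardy's inequality and exponential decay -/

theorem summable_int_of_nat {f : ℤ → ℝ} {a b : ℤ} (hba : b < a)
    (h1 : Summable fun n : ℕ => f (a + n)) (h2 : Summable fun n : ℕ => f (b - n)) :
    Summable f := by
  rw [← (Equiv.addLeft a).summable_iff]
  refine Summable.of_nat_of_neg_add_one (by simpa using h1) ?_
  obtain ⟨N, hN⟩ := Int.le.dest (Int.le_sub_one_of_lt hba)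
  rw [← summable_nat_add_iff N]
  refine h2.congr fun n => ?_
  simp only [Function.comp_apply, Equiv.coe_addLeft]
  congr 1
  push_cast
  omega

/-- A discrete Hardy inequality, in qualitative form. -/
theorem summable_mul_sq_of_summable_mul_sub_sq {w F u : ℕ → ℝ} {s : ℝ} (hs : 0 < s)
    (hw : ∀ n, 0 ≤ w n) (hF : ∀ n, 0 ≤ F n) (hws : Summable w)
    (hwF : ∀ n : ℕ, s * (n + 1) * w (n + 1) ≤ F n - F (n + 1))
    (hu : Summable fun n => F n * (u (n + 1) - u n) ^ 2) :
    Summable fun n => w n * u n ^ 2 := by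
  set Z : ℕ → ℝ := fun n => ∑ k ∈ Finset.range n, (u (k + 1) - u k) ^ 2 with hZ
  have hZ0 : ∀ n, 0 ≤ Z n := fun n => Finset.sum_nonneg fun k _ => sq_nonneg _
  have hy : ∀ n : ℕ, (u n - u 0) ^ 2 ≤ n * Z n := by
    intro n
    have := sq_sum_le_card_mul_sum_sq (s := Finset.range n) (f := fun k => u (k + 1) - u k)
    rwa [Finset.sum_range_sub, Finset.card_range] at this
  -- Abel summation done by induction: Cauchy–Schwarz bounds (u n - u 0)² by n Z n, and the drop of
  -- F pays for the factor n.
  have key : ∀ N : ℕ, s * ∑ k ∈ Finset.range N, w (k + 1) * (u (k + 1) - u 0) ^ 2 + F N * Z N ≤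
      ∑ k ∈ Finset.range N, F k * (u (k + 1) - u k) ^ 2 := by
    intro N
    induction N with
    | zero => simp [hZ]
    | succ N ih =>
      rw [Finset.sum_range_succ, Finset.sum_range_succ _ N]
      have hZs : Z (N + 1) = Z N + (u (N + 1) - u N) ^ 2 := Finset.sum_range_succ _ _
      have h1 := mul_le_mul_of_nonneg_left (hy (N + 1)) (mul_nonneg hs.le (hw (N + 1)))
      have h2 := mul_le_mul_of_nonneg_right (hwF N) (hZ0 (N + 1))
      push_cast at h1
      have h3 : F N * Z (N + 1) = F N * Z N + F N * (u (N + 1) - u N) ^ 2 := by rw [hZs]; ring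
      linarith
  have hsum : Summable fun k => w (k + 1) * (u (k + 1) - u 0) ^ 2 := by
    refine summable_of_sum_range_le (c := (∑' k, F k * (u (k + 1) - u k) ^ 2) / s)
      (fun k => mul_nonneg (hw _) (sq_nonneg _)) fun N => ?_
    rw [le_div_iff₀ hs, mul_comm]
    have h1 := key N
    have h2 := hu.sum_le_tsum (Finset.range N) fun k _ => mul_nonneg (hF k) (sq_nonneg _)
    have h3 := mul_nonneg (hF N) (hZ0 N)
    linarith
  rw [← summable_nat_add_iff 1]
  refine Summable.of_nonneg_of_le (fun n => mul_nonneg (hw _) (sq_nonneg _)) (fun n => ?_)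
    ((hsum.mul_left 2).add (((summable_nat_add_iff 1).2 hws).mul_right (2 * u 0 ^ 2)))
  have h1 : u (n + 1) ^ 2 ≤ 2 * (u (n + 1) - u 0) ^ 2 + 2 * u 0 ^ 2 := by
    nlinarith [sq_nonneg (u (n + 1) - 2 * u 0)]
  nlinarith [mul_le_mul_of_nonneg_left h1 (hw (n + 1))]

/-- F decays like r^n; spending half of the rate -log r leaves a convergent geometric series. -/
theorem summable_mul_exp_of_geometric {w F : ℕ → ℝ} {r : ℝ} (hr : 0 < r) (hr1 : r < 1)
    (hw : ∀ n, 0 ≤ w n) (hwF : ∀ n, w n ≤ F n) (hF : ∀ n, F (n + 1) ≤ r * F n) :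
    Summable fun n : ℕ => w n * Real.exp (-(Real.log r / 2) * n) := by
  have hlog := Real.log_neg hr hr1
  have h1 : ∀ n : ℕ, F n ≤ r ^ n * F 0 := by
    intro n
    induction n with
    | zero => simp
    | succ n ih =>
      calc F (n + 1) ≤ r * F n := hF n
        _ ≤ r * (r ^ n * F 0) := by gcongr
        _ = _ := by ring
  have hg : Summable fun n : ℕ => F 0 * Real.exp (Real.log r / 2) ^ n :=
    (summable_geometric_of_lt_one (Real.exp_pos _).le
      (Real.exp_lt_one_iff.2 (by linarith))).mul_left _
  refine Summable.of_nonneg_of_le (fun n => mul_nonneg (hw n) (Real.exp_pos _).le) (fun n => ?_) hg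
  have h2 : r ^ n = Real.exp (Real.log r * n) := by
    rw [Real.exp_mul, Real.exp_log hr, Real.rpow_natCast]
  calc w n * Real.exp (-(Real.log r / 2) * n)
      ≤ r ^ n * F 0 * Real.exp (-(Real.log r / 2) * n) := by
        gcongr
        exact (hwF n).trans (h1 n)
    _ = F 0 * (Real.exp (Real.log r * n) * Real.exp (-(Real.log r / 2) * n)) := by rw [h2]; ring
    _ = _ := by
      rw [← Real.exp_add, ← Real.exp_nat_mul]
      congr 2; ring

/-- The recurrence with a quadratic `q` of nonpositive leading coefficient forces exponential
decay. -/
theorem exists_summable_mul_exp (hp : ∀ j, 0 ≤ p j) (hqp : ∀ j, 0 ≤ quad δ β γ j * p j)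
    (hrec : ∀ j, quad δ β γ j * p j - quad δ β γ (j - 1) * p (j - 1) = (μ - j) * p j)
    (hδ : δ ≤ 0) :
    ∃ t > 0, Summable fun j : ℤ => p j * Real.exp (t * |(j : ℝ)|) := by
  -- D is chosen so that q(j) ≤ D|j - μ| at distance at least 1 from μ; the quadratic term is
  -- dropped because δ ≤ 0.
  set D : ℝ := |β| * (1 + |μ|) + |γ| + 1 with hD
  have hD1 : 1 ≤ D := by
    have : 0 ≤ |β| * (1 + |μ|) + |γ| := by positivity
    linarith
  have hbound : ∀ j : ℤ, 1 ≤ |(j : ℝ) - μ| →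
      quad δ β γ j * p j ≤ D * (|(j : ℝ) - μ| * p j) := by
    intro j hj
    rw [← mul_assoc]
    refine mul_le_mul_of_nonneg_right ?_ (hp j)
    have h1 : δ * (j : ℝ) ^ 2 ≤ 0 := mul_nonpos_of_nonpos_of_nonneg hδ (sq_nonneg _)
    have h2 : |(j : ℝ)| ≤ |(j : ℝ) - μ| + |μ| := by
      simpa using abs_add_le ((j : ℝ) - μ) μ
    have h3 : β * j ≤ |β| * |(j : ℝ)| := by rw [← abs_mul]; exact le_abs_self _
    have h4 := le_abs_self γ
    have h5 : |β| * |(j : ℝ)| ≤ |β| * ((1 + |μ|) * |(j : ℝ) - μ|) := by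
      refine mul_le_mul_of_nonneg_left ?_ (abs_nonneg _)
      nlinarith [abs_nonneg μ]
    have h6 : |γ| ≤ |γ| * |(j : ℝ) - μ| := le_mul_of_one_le_right (abs_nonneg _) hj
    rw [quad, hD]
    nlinarith
  -- Moving one step away from μ removes |j - μ|p(j) ≥ q(j)p(j)/D on the upper side, so the flux qp
  -- shrinks by at least the factor 1/(1 + 1/D); the lower side gives a smaller factor still.
  set r : ℝ := D / (1 + D) with hr
  have hr0 : 0 < r := by positivity
  have hr1 : r < 1 := by rw [hr, div_lt_one (by positivity)]; linarith
  have hlog := Real.log_neg hr0 hr1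
  set t : ℝ := -(Real.log r / 2) with ht
  have ht0 : 0 < t := by linarith
  set a : ℤ := ⌈μ⌉ + 1 with ha
  set b : ℤ := ⌊μ⌋ - 1 with hb
  have haμ : μ + 1 ≤ a := by rw [ha]; push_cast; linarith [Int.le_ceil μ]
  have hbμ : (b : ℝ) ≤ μ - 1 := by rw [hb]; push_cast; linarith [Int.floor_le μ]
  have hup := summable_mul_exp_of_geometric (w := fun n : ℕ => p (a + n))
    (F := fun n : ℕ => quad δ β γ (a + n - 1) * p (a + n - 1)) hr0 hr1 (fun n => hp _)
    (fun n => by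
      have h1 := hrec (a + n)
      have h2 : (1 : ℝ) ≤ ((a + n : ℤ) : ℝ) - μ := by
        push_cast; linarith [(Nat.cast_nonneg n : (0 : ℝ) ≤ n)]
      nlinarith [mul_le_mul_of_nonneg_right h2 (hp (a + n)), hqp (a + n)])
    (fun n => by
      have h1 := hrec (a + n)
      have h2 : (1 : ℝ) ≤ ((a + n : ℤ) : ℝ) - μ := by
        push_cast; linarith [(Nat.cast_nonneg n : (0 : ℝ) ≤ n)]
      have h3 := hbound (a + n) (h2.trans (le_abs_self _))
      rw [abs_of_pos (by linarith)] at h3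
      have h4 : a + ((n + 1 : ℕ) : ℤ) - 1 = a + n := by push_cast; ring
      rw [h4, hr, div_mul_eq_mul_div, le_div_iff₀ (by positivity)]
      nlinarith)
  have hdown := summable_mul_exp_of_geometric (w := fun n : ℕ => p (b - n))
    (F := fun n : ℕ => quad δ β γ (b - n) * p (b - n)) hr0 hr1 (fun n => hp _)
    (fun n => by
      have h1 := hrec (b - n)
      have h2 : (1 : ℝ) ≤ μ - ((b - n : ℤ) : ℝ) := by
        push_cast; linarith [(Nat.cast_nonneg n : (0 : ℝ) ≤ n)]
      nlinarith [mul_le_mul_of_nonneg_right h2 (hp (b - n)), hqp (b - n - 1)])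
    (fun n => by
      have h1 := hrec (b - n)
      have h2 : (1 : ℝ) ≤ μ - ((b - n : ℤ) : ℝ) := by
        push_cast; linarith [(Nat.cast_nonneg n : (0 : ℝ) ≤ n)]
      have h3 := hbound (b - n) (by rw [abs_sub_comm]; exact h2.trans (le_abs_self _))
      rw [abs_sub_comm, abs_of_pos (by linarith)] at h3
      have h4 : b - ((n + 1 : ℕ) : ℤ) = b - n - 1 := by push_cast; ring
      rw [h4, hr, div_mul_eq_mul_div, le_div_iff₀ (by positivity)]
      have h5 := mul_nonneg (by linarith : 0 ≤ μ - ((b - n : ℤ) : ℝ)) (hp (b - n))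
      have h6 : D * (quad δ β γ (b - n) * p (b - n) - quad δ β γ (b - n - 1) * p (b - n - 1)) =
        D * ((μ - ((b - n : ℤ) : ℝ)) * p (b - n)) := by rw [h1]
      linarith)
  have hexp : ∀ (c e : ℤ) (n : ℕ), |((c : ℤ) : ℝ)| ≤ |((e : ℤ) : ℝ)| + n → ∀ x : ℝ, 0 ≤ x →
      x * Real.exp (t * |(c : ℝ)|) ≤ Real.exp (t * |(e : ℝ)|) * (x * Real.exp (t * n)) := by
    intro c e n hc x hx
    have : Real.exp (t * |(c : ℝ)|) ≤ Real.exp (t * |(e : ℝ)|) * Real.exp (t * n) := by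
      rw [← Real.exp_add]
      exact Real.exp_le_exp.2 (by nlinarith)
    nlinarith [mul_le_mul_of_nonneg_left this hx]
  refine ⟨t, ht0, summable_int_of_nat (a := a) (b := b) ?_ ?_ ?_⟩
  · have : (b : ℝ) < a := by linarith
    exact_mod_cast this
  · refine Summable.of_nonneg_of_le (fun n => mul_nonneg (hp _) (Real.exp_pos _).le) (fun n => ?_)
      (hup.mul_left (Real.exp (t * |(a : ℝ)|)))
    refine hexp _ _ _ ?_ _ (hp _)
    push_cast
    simpa using abs_add_le (a : ℝ) n
  · refine Summable.of_nonneg_of_le (fun n => mul_nonneg (hp _) (Real.exp_pos _).le) (fun n => ?_)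
      (hdown.mul_left (Real.exp (t * |(b : ℝ)|)))
    refine hexp _ _ _ ?_ _ (hp _)
    push_cast
    simpa using abs_sub (b : ℝ) n

/-! ### Poincaré inequality and positivity of 1 - 2iδ -/

namespace OrdWeight

theorem wt_succ_sub (h : OrdWeight p μ δ β γ) (i : ℕ) (j : ℤ) :
    wt p δ β γ (i + 1) j - wt p δ β γ (i + 1) (j - 1) =
      (μ + δ * (i : ℝ) ^ 2 + β * i - (1 - 2 * i * δ) * j) * wt p δ β γ i j := by
  rw [h.wt_succ_sub_one, wt_succ, quad, quad]
  push_cast; ring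

theorem summable_wt (h : OrdWeight p μ δ β γ) (i : ℕ) : Summable (wt p δ β γ i) := by
  simpa using h.summable_wt_eval i 1

/-- A qualitative Poincaré inequality. -/
theorem summable_sq_of_summable_fwdDiff_sq (h : OrdWeight p μ δ β γ) {i : ℕ}
    (hs : 0 < 1 - 2 * (i : ℝ) * δ) {u : ℤ → ℝ}
    (hu : Summable fun j => wt p δ β γ (i + 1) j * (fwdDiff 1 u j) ^ 2) :
    Summable fun j => wt p δ β γ i j * u j ^ 2 := by
  set s : ℝ := 1 - 2 * (i : ℝ) * δ with hsdef
  set ρ : ℝ := μ + δ * (i : ℝ) ^ 2 + β * i with hρ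
  -- ρ/s is where the drift ρ - s j of `wt_succ_sub` changes sign; Hardy's inequality is applied on
  -- each side of it.
  set b : ℤ := ⌊ρ / s⌋ with hb
  have hb1 : s * b ≤ ρ := by
    have := Int.floor_le (ρ / s)
    rw [le_div_iff₀ hs] at this
    linarith
  have hb2 : ρ ≤ s * (b + 1) := by
    have := Int.lt_floor_add_one (ρ / s)
    rw [div_lt_iff₀ hs] at this
    linarith
  refine summable_int_of_nat (a := b + 1) (b := b) (by omega) ?_ ?_
  · have hinj : Function.Injective fun n : ℕ => b + 1 + (n : ℤ) := fun m n hmn => by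
      simpa using hmn
    refine summable_mul_sq_of_summable_mul_sub_sq (w := fun n : ℕ => wt p δ β γ i (b + 1 + n))
      (F := fun n : ℕ => wt p δ β γ (i + 1) (b + 1 + n)) (u := fun n : ℕ => u (b + 1 + n)) hs
      (fun n => h.wt_nonneg _ _) (fun n => h.wt_nonneg _ _)
      ((h.summable_wt i).comp_injective hinj) (fun n => ?_)
      ((hu.comp_injective hinj).congr fun n => ?_)
    · have h1 := h.wt_succ_sub i (b + 1 + (n + 1 : ℕ))
      have h2 : b + 1 + ((n + 1 : ℕ) : ℤ) - 1 = b + 1 + n := by push_cast; ring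
      rw [h2] at h1
      have h3 : s * (n + 1) ≤ s * ((b + 1 + (n + 1 : ℕ) : ℤ) : ℝ) - ρ := by push_cast; linarith
      have h4 := mul_le_mul_of_nonneg_right h3 (h.wt_nonneg i (b + 1 + (n + 1 : ℕ)))
      linarith
    · simp [fwdDiff, add_assoc]
  · have hinj : Function.Injective fun n : ℕ => b - (n : ℤ) := fun m n hmn => by
      simpa using hmn
    have hinj' : Function.Injective fun n : ℕ => b - 1 - (n : ℤ) := fun m n hmn => by
      simpa using hmn
    refine summable_mul_sq_of_summable_mul_sub_sq (w := fun n : ℕ => wt p δ β γ i (b - n))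
      (F := fun n : ℕ => wt p δ β γ (i + 1) (b - 1 - n)) (u := fun n : ℕ => u (b - n)) hs
      (fun n => h.wt_nonneg _ _) (fun n => h.wt_nonneg _ _)
      ((h.summable_wt i).comp_injective hinj) (fun n => ?_)
      ((hu.comp_injective hinj').congr fun n => ?_)
    · have h1 := h.wt_succ_sub i (b - (n + 1 : ℕ))
      have h2 : b - 1 - ((n + 1 : ℕ) : ℤ) = b - (n + 1 : ℕ) - 1 := by ring
      have h2' : b - 1 - (n : ℤ) = b - (n + 1 : ℕ) := by push_cast; ring
      rw [h2, h2']
      have h3 : s * (n + 1) ≤ ρ - s * ((b - (n + 1 : ℕ) : ℤ) : ℝ) := by push_cast; linarith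
      have h4 := mul_le_mul_of_nonneg_right h3 (h.wt_nonneg i (b - (n + 1 : ℕ)))
      linarith
    · have h5 : b - 1 - (n : ℤ) + 1 = b - n := by ring
      have h6 : b - 1 - (n : ℤ) = b - (n + 1 : ℕ) := by push_cast; ring
      simp only [Function.comp_apply, fwdDiff, h5]
      rw [h6, ← neg_sq (u (b - (n + 1 : ℕ)) - _), neg_sub]

/-- Summation by parts against x - c, with c the mean of the weight q^{[i]}p, shows that (1 - 2iδ)
times the second central moment of that weight equals the mass of q^{[i+1]}p. -/
theorem one_sub_pos_of_tsum_pos (h : OrdWeight p μ δ β γ) {i : ℕ}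
    (hi : 0 < ∑' j, wt p δ β γ (i + 1) j) : 0 < 1 - 2 * (i : ℝ) * δ := by
  set s : ℝ := 1 - 2 * (i : ℝ) * δ with hsdef
  set ρ : ℝ := μ + δ * (i : ℝ) ^ 2 + β * i with hρ
  have hadj : ∀ j : ℤ, (adj μ δ β γ i 1).eval (j : ℝ) = s * j - ρ := by
    intro j
    rw [eval_adj, quad, quad]
    push_cast [eval_one, hsdef, hρ]; ring
  have hibp : ∀ V : ℝ[X], ∑' j : ℤ, wt p δ β γ i j * (V.eval (j : ℝ) * (s * j - ρ)) =
      ∑' j : ℤ, wt p δ β γ (i + 1) j * (fwdDiff 1 (fun j : ℤ => V.eval (j : ℝ)) j) := by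
    intro V
    have := h.tsum_mul_adj (h.mod_eval i V) 1
    simpa [hadj] using this
  have hE0 : 0 < ∑' j, wt p δ β γ i j := by
    refine lt_of_le_of_ne (tsum_nonneg (h.wt_nonneg i)) fun h0 => ?_
    have h1 := (h.summable_wt i).hasSum
    rw [← h0] at h1
    have h2 := (hasSum_zero_iff_of_nonneg (h.wt_nonneg i)).1 h1
    refine hi.ne' ?_
    convert tsum_zero with j
    rw [wt_succ, h2]; simp
  set c : ℝ := (∑' j : ℤ, wt p δ β γ i j * j) / ∑' j, wt p δ β γ i j with hc
  have hm1 : Summable fun j : ℤ => wt p δ β γ i j * j := by simpa using h.summable_wt_eval i X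
  have hc0 : ∑' j : ℤ, wt p δ β γ i j * ((j : ℝ) - c) = 0 := by
    have : ∀ j : ℤ, wt p δ β γ i j * ((j : ℝ) - c) =
        wt p δ β γ i j * j - wt p δ β γ i j * c := fun j => by ring
    rw [tsum_congr this, hm1.tsum_sub ((h.summable_wt i).mul_right c), tsum_mul_right, hc]
    field_simp
    ring
  have h2 := hibp (X - C c)
  have h3 : ∀ j : ℤ, wt p δ β γ i j * ((X - C c).eval (j : ℝ) * (s * j - ρ)) =
      s * (wt p δ β γ i j * ((j : ℝ) - c) ^ 2) + (s * c - ρ) * (wt p δ β γ i j * ((j : ℝ) - c)) := by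
    intro j; simp; ring
  have hs2 : Summable fun j : ℤ => wt p δ β γ i j * ((j : ℝ) - c) ^ 2 := by
    exact (h.summable_wt_eval i ((X - C c) ^ 2)).congr fun j => by
      rw [eval_pow, eval_sub, eval_X, eval_C]
  have hs1 : Summable fun j : ℤ => wt p δ β γ i j * ((j : ℝ) - c) := by
    exact (h.summable_wt_eval i (X - C c)).congr fun j => by rw [eval_sub, eval_X, eval_C]
  rw [tsum_congr h3, (hs2.mul_left s).tsum_add (hs1.mul_left _), tsum_mul_left, tsum_mul_left, hc0,
    mul_zero, add_zero] at h2
  have h4 : ∑' j : ℤ, wt p δ β γ (i + 1) j * (fwdDiff 1 (fun j : ℤ => (X - C c).eval (j : ℝ)) j) =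
      ∑' j : ℤ, wt p δ β γ (i + 1) j := by
    refine tsum_congr fun j => ?_
    simp [fwdDiff]
  rw [h4] at h2
  rw [← h2] at hi
  exact pos_of_mul_pos_left hi (tsum_nonneg fun j => mul_nonneg (h.wt_nonneg i j) (sq_nonneg _))

end OrdWeight

open scoped InnerProductSpace ENNReal in
/-- Parseval's identity for a complete orthogonal sequence in a weighted `ℓ²` space on `ℤ`. -/
theorem hasSum_weighted_sq_div {w : ℤ → ℝ} (hw : ∀ j, 0 ≤ w j) (φ : ℕ → ℤ → ℝ)
    (hφ : ∀ k, Summable fun j => w j * φ k j ^ 2)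
    (horth : ∀ k l, k ≠ l → ∑' j, w j * (φ k j * φ l j) = 0)
    (hcomp : ∀ f : ℤ → ℝ, (Summable fun j => w j * f j ^ 2) →
      (∀ k, ∑' j, w j * (f j * φ k j) = 0) → ∀ j, w j * f j = 0)
    {f : ℤ → ℝ} (hf : Summable fun j => w j * f j ^ 2) :
    HasSum (fun k => (∑' j, w j * (f j * φ k j)) ^ 2 / ∑' j, w j * (φ k j * φ k j))
      (∑' j, w j * f j ^ 2) := by
  -- Multiplication by √w transports the weighted space to ℓ² of the set where w is nonzero.
  set S : Set ℤ := {j | w j ≠ 0} with hS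
  have hmem : ∀ f : ℤ → ℝ, (Summable fun j => w j * f j ^ 2) →
      Memℓp (fun j : S => √(w j) * f j) 2 := by
    intro f hf
    refine (memℓp_gen_iff (by norm_num)).2 ((hf.subtype S).congr fun j => ?_)
    simp [mul_pow, Real.sq_sqrt (hw j.1)]
  have hsub : ∀ f : ℤ → ℝ, ∑' j : S, w j * f j = ∑' j, w j * f j := by
    intro f
    refine tsum_subtype_eq_of_support_subset (f := fun j => w j * f j) fun j hj => ?_
    exact left_ne_zero_of_mul hj
  set e : ℕ → lp (fun _ : S => ℝ) 2 := fun k => ⟨_, hmem (φ k) (hφ k)⟩ with he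
  have hin : ∀ (f g : ℤ → ℝ) (hf : Summable fun j => w j * f j ^ 2)
      (hg : Summable fun j => w j * g j ^ 2),
      ⟪(⟨_, hmem f hf⟩ : lp (fun _ : S => ℝ) 2), ⟨_, hmem g hg⟩⟫_ℝ =
        ∑' j, w j * (g j * f j) := by
    intro f g hf hg
    rw [lp.inner_eq_tsum, ← hsub]
    refine tsum_congr fun j => ?_
    simp only [RCLike.inner_apply, conj_trivial]
    linear_combination (g j * f j) * Real.mul_self_sqrt (hw j)
  have h := hasSum_inner_sq_div e (fun k l hkl => by
    exact (hin (φ k) (φ l) (hφ k) (hφ l)).trans (horth l k hkl.symm)) (fun y hy => ?_) ⟨_, hmem f hf⟩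
  · have h2 : ‖(⟨_, hmem f hf⟩ : lp (fun _ : S => ℝ) 2)‖ ^ 2 = ∑' j, w j * f j ^ 2 := by
      rw [← real_inner_self_eq_norm_sq, hin f f hf hf]
      exact tsum_congr fun j => by ring
    rw [h2] at h
    convert h using 4 with k
    · exact (hin (φ k) f (hφ k) hf).symm
    · rw [← real_inner_self_eq_norm_sq]
      exact (hin (φ k) (φ k) (hφ k) (hφ k)).symm
  · classical
    set F : ℤ → ℝ := fun j => if hj : j ∈ S then y ⟨j, hj⟩ / √(w j) else 0 with hF
    have hsq : ∀ j : S, √(w j) ≠ 0 := fun j =>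
      (Real.sqrt_pos.2 (lt_of_le_of_ne (hw j) (Ne.symm j.2))).ne'
    have hyF : ∀ j : S, y j = √(w j) * F j := by
      intro j
      have := hsq j
      simp only [hF, j.2, dif_pos]
      field_simp
    have hFs : Summable fun j => w j * F j ^ 2 := by
      have h1 := (memℓp_gen_iff (by norm_num)).1 (lp.memℓp y)
      have h2 : Summable ((fun j => w j * F j ^ 2) ∘ ((↑) : S → ℤ)) := by
        refine h1.congr fun j => ?_
        rw [hyF]
        simp [mul_pow, Real.sq_sqrt (hw j.1)]
      rwa [summable_subtype_iff_indicator, Set.indicator_eq_self.2] at h2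
      intro j hj
      exact left_ne_zero_of_mul hj
    have hyeq : y = ⟨_, hmem F hFs⟩ := by
      ext j; exact hyF j
    have h3 := hcomp F hFs fun k => by
      have := hy k
      rw [hyeq] at this
      exact (hin (φ k) F (hφ k) hFs).symm.trans this
    ext j
    rw [hyF, (mul_eq_zero.1 (h3 j)).resolve_left j.2]
    simp

/-! ### Orthogonal polynomials: Rodrigues formula, norms, completeness -/

theorem natDegree_comp_add_sub_le {V : ℝ[X]} {d : ℕ} (hV : V.natDegree ≤ d + 1) (a : ℝ) :
    (V.comp (X + C a) - V).natDegree ≤ d := by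
  rcases eq_or_ne V.natDegree 0 with h0 | h0
  · rw [eq_C_of_natDegree_eq_zero h0]; simp
  have hV0 : V ≠ 0 := fun h => h0 (by simp [h])
  have h1 := degree_sub_lt_left (p := taylor a V) (q := V) (degree_taylor V a)
    (by simpa using hV0) (leadingCoeff_taylor a V)
  rw [degree_taylor, degree_eq_natDegree hV0, taylor_apply] at h1
  have h2 : V.natDegree = (V.natDegree - 1) + 1 := by omega
  rw [h2] at h1
  rcases eq_or_ne (V.comp (X + C a) - V) 0 with hz | hz
  · simp [hz]
  have h3 := (natDegree_lt_iff_degree_lt hz).2 h1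
  omega

/-- The orthogonal polynomials of the weights `q^{[i]} p`. -/
def ordPoly (μ δ β γ : ℝ) : ℕ → ℕ → ℝ[X]
  | _, 0 => 1
  | i, k + 1 => adj μ δ β γ i (ordPoly μ δ β γ (i + 1) k)

/-- The difference `λ_k - λ_r` of the eigenvalues `λ_k = k (1 - (k - 1) δ)`. -/
def gap (δ : ℝ) (k r : ℕ) : ℝ := ((k : ℝ) - r) * (1 - ((k : ℝ) + r - 1) * δ)

/-- The commutation rule Δ∘adj_i = adj_{i+1}∘Δ + (1 - 2iδ), for V with ΔV = cW. Its constants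
accumulate into the eigenvalue differences. -/
theorem eval_adj_add_one_sub {V W : ℝ[X]} {c : ℝ}
    (hV : ∀ j : ℤ, V.eval ((j : ℝ) + 1) - V.eval (j : ℝ) = c * W.eval (j : ℝ)) (i : ℕ) (j : ℤ) :
    (adj μ δ β γ i V).eval ((j : ℝ) + 1) - (adj μ δ β γ i V).eval (j : ℝ) =
      c * (adj μ δ β γ (i + 1) W).eval (j : ℝ) + (1 - 2 * i * δ) * V.eval (j : ℝ) := by
  have h1 := eval_adj (μ := μ) (δ := δ) (β := β) (γ := γ) i V (j + 1)
  have h2 := hV (j - 1)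
  push_cast at h1 h2
  rw [sub_add_cancel] at h2
  rw [add_sub_cancel_right] at h1
  rw [h1, eval_adj, eval_adj]
  simp only [quad]
  push_cast
  linear_combination (-(δ * (j + i + 1) ^ 2 + β * (j + i + 1) + γ)) * hV j +
    (δ * (j : ℝ) ^ 2 + β * j + γ - μ + j) * h2

theorem ordPoly_add_one_sub (i k : ℕ) (j : ℤ) :
    (ordPoly μ δ β γ i (k + 1)).eval ((j : ℝ) + 1) - (ordPoly μ δ β γ i (k + 1)).eval (j : ℝ) =
      gap δ (i + k + 1) i * (ordPoly μ δ β γ (i + 1) k).eval (j : ℝ) := by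
  induction k generalizing i j with
  | zero =>
    have h1 := eval_adj_add_one_sub (μ := μ) (δ := δ) (β := β) (γ := γ) (V := 1) (W := 0) (c := 0)
      (by simp) i j
    rw [zero_add, ordPoly, ordPoly, ordPoly, h1, gap]
    push_cast
    ring
  | succ k ih =>
    rw [ordPoly, eval_adj_add_one_sub (ih (i + 1))]
    rw [ordPoly, gap, gap]
    push_cast
    ring

theorem fwdDiff_ordPoly (i k : ℕ) :
    fwdDiff 1 (fun j : ℤ => (ordPoly μ δ β γ i (k + 1)).eval (j : ℝ)) =
      fun j : ℤ => gap δ (i + k + 1) i * (ordPoly μ δ β γ (i + 1) k).eval (j : ℝ) := by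
  ext j
  rw [← ordPoly_add_one_sub]
  simp [fwdDiff]

theorem natDegree_adj_le {V : ℝ[X]} {d : ℕ} (hV : V.natDegree ≤ d) (i : ℕ) :
    (adj μ δ β γ i V).natDegree ≤ d + 1 := by
  have hQ : (quadPoly δ β γ).natDegree ≤ 2 := natDegree_quadratic_le
  have hX : (X - C 1 : ℝ[X]) = X + C (-1) := by simp [sub_eq_add_neg]
  -- Regrouped so that each quadratic factor meets a difference of V, or is itself differenced; the
  -- apparent degree d + 2 disappears.
  have h1 : adj μ δ β γ i V = quadPoly δ β γ * (V.comp (X + C (-1)) - V) +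
      (X - C μ) * V.comp (X + C (-1)) -
      ((quadPoly δ β γ).comp (X + C (i : ℝ)) - quadPoly δ β γ) * V := by
    rw [adj, hX]; ring
  have hV' : (V.comp (X + C (-1))).natDegree ≤ d := by
    rw [natDegree_comp, natDegree_X_add_C, mul_one]; exact hV
  rw [h1]
  refine (natDegree_sub_le _ _).trans (max_le (natDegree_add_le_of_degree_le ?_ ?_) ?_)
  · rcases d with _ | e
    · rw [eq_C_of_natDegree_le_zero hV]; simp
    · exact (natDegree_mul_le_of_le hQ (natDegree_comp_add_sub_le hV (-1))).trans (by omega)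
  · exact (natDegree_mul_le_of_le (natDegree_X_sub_C μ).le hV').trans (by omega)
  · exact (natDegree_mul_le_of_le (natDegree_comp_add_sub_le hQ _) hV).trans (by omega)

theorem natDegree_ordPoly_le (i k : ℕ) : (ordPoly μ δ β γ i k).natDegree ≤ k := by
  induction k generalizing i with
  | zero => simp [ordPoly]
  | succ k ih => exact natDegree_adj_le (ih _) i

theorem diff_succ (i : ℕ) (g : ℤ → ℝ) : diff (i + 1) g = fwdDiff 1 (diff i g) :=
  Function.iterate_succ_apply' _ _ _

theorem diff_succ' (i : ℕ) (g : ℤ → ℝ) : diff (i + 1) g = diff i (fwdDiff 1 g) :=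
  Function.iterate_succ_apply _ _ _

theorem diff_diff (k i : ℕ) (g : ℤ → ℝ) : diff k (diff i g) = diff (i + k) g := by
  rw [add_comm]; exact (Function.iterate_add_apply _ _ _ _).symm

theorem diff_const_mul (k : ℕ) (c : ℝ) (u : ℤ → ℝ) :
    diff k (fun j => c * u j) = fun j => c * diff k u j := by
  induction k with
  | zero => rfl
  | succ k ih =>
    rw [diff_succ, ih, diff_succ]
    ext j; simp only [fwdDiff]; ring

theorem diff_ordPoly_self (i k : ℕ) :
    diff k (fun j : ℤ => (ordPoly μ δ β γ i k).eval (j : ℝ)) =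
      fun _ => ∏ r ∈ Finset.range k, gap δ (i + k) (i + r) := by
  induction k generalizing i with
  | zero => simp [diff, ordPoly]
  | succ k ih =>
    rw [diff_succ', fwdDiff_ordPoly, diff_const_mul, ih, Finset.prod_range_succ']
    ext j
    rw [mul_comm]
    congr 1
    refine Finset.prod_congr rfl fun r _ => ?_
    rw [show i + 1 + k = i + (k + 1) by ring, show i + 1 + r = i + (r + 1) by ring]

theorem diff_ordPoly_of_lt (i : ℕ) {l k : ℕ} (h : l < k) :
    diff k (fun j : ℤ => (ordPoly μ δ β γ i l).eval (j : ℝ)) = fun _ => 0 := by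
  obtain ⟨d, rfl⟩ := Nat.exists_eq_add_of_lt h
  rw [add_assoc, ← diff_diff, diff_ordPoly_self, diff_succ']
  have : fwdDiff (1 : ℤ) (fun _ : ℤ => ∏ r ∈ Finset.range l, gap δ (i + l) (i + r)) =
      fun j => 0 * (fun _ : ℤ => (0 : ℝ)) j := by
    ext j; simp [fwdDiff]
  rw [this, diff_const_mul]
  simp

namespace OrdWeight

theorem mod_diff (h : OrdWeight p μ δ β γ) {g : ℤ → ℝ} {i : ℕ} (hg : Mod (wt p δ β γ i) g)
    (k : ℕ) : Mod (wt p δ β γ (i + k)) (diff k g) := by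
  induction k with
  | zero => exact hg
  | succ k ih => rw [diff_succ]; exact h.mod_fwdDiff ih

/-- Each of the k adjoints moves one difference onto u. With u another member of the family this
yields orthogonality and norms. -/
theorem tsum_mul_ordPoly (h : OrdWeight p μ δ β γ) {i : ℕ} {u : ℤ → ℝ}
    (hu : Mod (wt p δ β γ i) u) (k : ℕ) :
    ∑' j : ℤ, wt p δ β γ i j * (u j * (ordPoly μ δ β γ i k).eval (j : ℝ)) =
      ∑' j : ℤ, wt p δ β γ (i + k) j * diff k u j := by
  induction k generalizing i u with
  | zero => simp [ordPoly, diff]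
  | succ k ih =>
    rw [ordPoly, h.tsum_mul_adj hu, ih (h.mod_fwdDiff hu), diff_succ',
      show i + 1 + k = i + (k + 1) by ring]

/-- The squared norm of `ordPoly i k` in `ℓ²(q^{[i]} p)`. -/
theorem tsum_ordPoly_sq (h : OrdWeight p μ δ β γ) (i k : ℕ) :
    ∑' j : ℤ, wt p δ β γ i j * ((ordPoly μ δ β γ i k).eval (j : ℝ) *
      (ordPoly μ δ β γ i k).eval (j : ℝ)) =
      (∏ r ∈ Finset.range k, gap δ (i + k) (i + r)) * ∑' j, wt p δ β γ (i + k) j := by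
  rw [h.tsum_mul_ordPoly (h.mod_eval i _), diff_ordPoly_self, tsum_mul_right, mul_comm]

theorem tsum_ordPoly_mul (h : OrdWeight p μ δ β γ) (i : ℕ) {k l : ℕ} (hkl : k ≠ l) :
    ∑' j : ℤ, wt p δ β γ i j * ((ordPoly μ δ β γ i k).eval (j : ℝ) *
      (ordPoly μ δ β γ i l).eval (j : ℝ)) = 0 := by
  wlog hlt : k < l generalizing k l
  · rw [← this hkl.symm (by omega)]
    exact tsum_congr fun j => by ring
  rw [h.tsum_mul_ordPoly (h.mod_eval i _), diff_ordPoly_of_lt i hlt]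
  simp

/-- If `q^{[k]} p` has positive mass, then `1 - x δ` is positive for `0 ≤ x ≤ 2 k - 2`. -/
theorem one_sub_mul_pos (h : OrdWeight p μ δ β γ) {k : ℕ} (hk : 0 < ∑' j, wt p δ β γ k j) {x : ℝ}
    (hx : 0 ≤ x) (hxk : x + 2 ≤ 2 * k) : 0 < 1 - x * δ := by
  rcases le_or_gt δ 0 with hδ | hδ
  · nlinarith
  obtain ⟨i, rfl⟩ : ∃ i, k = i + 1 := Nat.exists_eq_succ_of_ne_zero (by
    rintro rfl; norm_num at hxk; linarith)
  have := h.one_sub_pos_of_tsum_pos hk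
  push_cast at hxk
  nlinarith

theorem gap_pos (h : OrdWeight p μ δ β γ) {k r : ℕ} (hk : 0 < ∑' j, wt p δ β γ k j) (hr : r < k) :
    0 < gap δ k r := by
  have h1 : (r : ℝ) + 1 ≤ k := by exact_mod_cast hr
  have h0 : (0 : ℝ) ≤ r := Nat.cast_nonneg r
  exact mul_pos (by linarith) (h.one_sub_mul_pos hk (by linarith) (by linarith))

theorem tsum_wt_nonneg (h : OrdWeight p μ δ β γ) (k : ℕ) : 0 ≤ ∑' j, wt p δ β γ k j :=
  tsum_nonneg (h.wt_nonneg k)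

theorem tsum_wt_pos_of_ne_zero (h : OrdWeight p μ δ β γ) {k : ℕ} {j : ℤ}
    (hj : wt p δ β γ k j ≠ 0) : 0 < ∑' j, wt p δ β γ k j :=
  (h.summable_wt k).tsum_pos (h.wt_nonneg k) j (lt_of_le_of_ne (h.wt_nonneg k j) hj.symm)

theorem summable_wt_eval_sq (h : OrdWeight p μ δ β γ) (i : ℕ) (V : ℝ[X]) :
    Summable fun j : ℤ => wt p δ β γ i j * V.eval (j : ℝ) ^ 2 :=
  (h.summable_wt_eval i (V ^ 2)).congr fun j => by rw [eval_pow]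

/-- Its squared norm contains the mass of q^{[i+k]}p as a factor; this covers the degrees exceeding
a finite support. -/
theorem ordPoly_eq_zero (h : OrdWeight p μ δ β γ) {i k : ℕ}
    (hk : ∑' j, wt p δ β γ (i + k) j = 0) {j : ℤ} (hj : wt p δ β γ i j ≠ 0) :
    (ordPoly μ δ β γ i k).eval (j : ℝ) = 0 := by
  have h1 := h.tsum_ordPoly_sq i k
  rw [hk, mul_zero] at h1
  have h2 := (h.summable_wt_eval_sq i (ordPoly μ δ β γ i k)).hasSum
  have h3 : ∑' j : ℤ, wt p δ β γ i j * (ordPoly μ δ β γ i k).eval (j : ℝ) ^ 2 = 0 := by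
    rw [← h1]; exact tsum_congr fun j => by ring
  rw [h3] at h2
  have h4 := congrFun ((hasSum_zero_iff_of_nonneg fun j =>
    mul_nonneg (h.wt_nonneg i j) (sq_nonneg _)).1 h2) j
  simpa [hj] using h4

/-- On the support of `q^{[i]} p` every polynomial is a combination of the `ordPoly i k`. -/
theorem exists_eq_sum_ordPoly (h : OrdWeight p μ δ β γ) (d i : ℕ) {V : ℝ[X]}
    (hV : V.natDegree ≤ d) : ∃ c : ℕ → ℝ, ∀ j : ℤ, wt p δ β γ i j ≠ 0 →
      V.eval (j : ℝ) = ∑ k ∈ Finset.range (d + 1), c k * (ordPoly μ δ β γ i k).eval (j : ℝ) := by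
  induction d generalizing i V with
  | zero =>
    refine ⟨fun _ => V.coeff 0, fun j _ => ?_⟩
    rw [eq_C_of_natDegree_le_zero hV]
    simp [ordPoly]
  | succ d ih =>
    obtain ⟨c, hc⟩ := ih (i + 1) (natDegree_comp_add_sub_le hV 1)
    -- Coefficients of ΔV at level i+1 are lifted to level i by dividing by the gap. Without mass at
    -- level i+1+k the gap could vanish, but there the polynomial is zero on the support.
    set c' : ℕ → ℝ := fun k =>
      if 0 < ∑' j, wt p δ β γ (i + 1 + k) j then c k / gap δ (i + k + 1) i else 0 with hc'
    set u : ℤ → ℝ := fun j => V.eval (j : ℝ) -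
      ∑ k ∈ Finset.range (d + 1), c' k * (ordPoly μ δ β γ i (k + 1)).eval (j : ℝ) with hu
    have hconst : ∀ j, wt p δ β γ (i + 1) j ≠ 0 → u (j + 1) = u j := by
      intro j hj
      have h1 := hc j hj
      have h2 : ∑ k ∈ Finset.range (d + 1), c k * (ordPoly μ δ β γ (i + 1) k).eval (j : ℝ) =
          ∑ k ∈ Finset.range (d + 1), c' k * ((ordPoly μ δ β γ i (k + 1)).eval ((j : ℝ) + 1) -
            (ordPoly μ δ β γ i (k + 1)).eval (j : ℝ)) := by
        refine Finset.sum_congr rfl fun k _ => ?_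
        rw [ordPoly_add_one_sub]
        by_cases hk : 0 < ∑' j, wt p δ β γ (i + 1 + k) j
        · have hg := (h.gap_pos (k := i + k + 1) (r := i)
            (by rwa [show i + k + 1 = i + 1 + k by ring]) (by omega)).ne'
          simp only [hc', if_pos hk]
          field_simp
        · rw [h.ordPoly_eq_zero (le_antisymm (not_lt.1 hk) (h.tsum_wt_nonneg _)) hj]
          simp
      rw [h2] at h1
      simp only [eval_sub, eval_comp, eval_add, eval_X, eval_C, mul_sub,
        Finset.sum_sub_distrib] at h1
      simp only [hu]
      push_cast
      linarith
    obtain ⟨a, ha⟩ : ∃ a, ∀ j, wt p δ β γ i j ≠ 0 → u j = a := by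
      by_cases hex : ∃ j, wt p δ β γ i j ≠ 0
      · obtain ⟨j0, hj0⟩ := hex
        exact ⟨u j0, fun j hj => h.eq_of_fwdDiff_eq_zero hconst hj hj0⟩
      · exact ⟨0, fun j hj => absurd ⟨j, hj⟩ hex⟩
    refine ⟨fun k => Nat.casesOn k a c', fun j hj => ?_⟩
    rw [Finset.sum_range_succ', ← ha j hj]
    simp [hu, ordPoly]

theorem tsum_mul_eval_eq_zero (h : OrdWeight p μ δ β γ) {i : ℕ} {f : ℤ → ℝ}
    (hf : Mod (wt p δ β γ i) f)
    (h0 : ∀ k, ∑' j : ℤ, wt p δ β γ i j * (f j * (ordPoly μ δ β γ i k).eval (j : ℝ)) = 0)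
    (V : ℝ[X]) : ∑' j : ℤ, wt p δ β γ i j * (f j * V.eval (j : ℝ)) = 0 := by
  obtain ⟨c, hc⟩ := h.exists_eq_sum_ordPoly V.natDegree i (V := V) le_rfl
  have h1 : ∀ j : ℤ, wt p δ β γ i j * (f j * V.eval (j : ℝ)) =
      ∑ k ∈ Finset.range (V.natDegree + 1),
        c k * (wt p δ β γ i j * (f j * (ordPoly μ δ β γ i k).eval (j : ℝ))) := by
    intro j
    by_cases hj : wt p δ β γ i j = 0
    · simp [hj]
    rw [hc j hj, Finset.mul_sum, Finset.mul_sum]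
    exact Finset.sum_congr rfl fun k _ => by ring
  rw [tsum_congr h1, Summable.tsum_finsetSum fun k _ => (hf _).mul_left _]
  refine Finset.sum_eq_zero fun k _ => ?_
  rw [tsum_mul_left, h0, mul_zero]

/-- Completeness of the orthogonal polynomials. -/
theorem wt_mul_eq_zero (h : OrdWeight p μ δ β γ) {i : ℕ} {f : ℤ → ℝ}
    (hf : Summable fun j => wt p δ β γ i j * f j ^ 2)
    (h0 : ∀ k, ∑' j : ℤ, wt p δ β γ i j * (f j * (ordPoly μ δ β γ i k).eval (j : ℝ)) = 0)
    (j : ℤ) : wt p δ β γ i j * f j = 0 := by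
  obtain ⟨t, ht, hs⟩ := h.wt_exp_moment i
  have hs1 := hs 1
  refine eq_zero_of_moments_eq_zero (c := fun j => wt p δ β γ i j * f j) (half_pos ht) ?_
    (fun k => ?_) j
  -- From |f| e^{t|j|/2} ≤ f² + e^{t|j|}, the product of weight and f decays exponentially.
  · refine Summable.of_nonneg_of_le (fun j => by positivity) (fun j => ?_) (hf.add hs1)
    have h2 : Real.exp (t * |(j : ℝ)|) = Real.exp (t / 2 * |(j : ℝ)|) ^ 2 := by
      rw [sq, ← Real.exp_add]; congr 1; ring
    rw [h2, eval_one, mul_one, abs_mul, abs_of_nonneg (h.wt_nonneg i j), mul_assoc, ← mul_add]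
    refine mul_le_mul_of_nonneg_left ?_ (h.wt_nonneg i j)
    have h3 : f j ^ 2 = |f j| ^ 2 := (sq_abs _).symm
    nlinarith [sq_nonneg (|f j| - Real.exp (t / 2 * |(j : ℝ)|)), sq_nonneg (f j),
      sq_nonneg (Real.exp (t / 2 * |(j : ℝ)|))]
  · have := h.tsum_mul_eval_eq_zero (h.mod_of_sq hf) h0 (X ^ k)
    rw [← this]
    refine tsum_congr fun j => ?_
    rw [eval_pow, eval_X]; ring

/-- Parseval's identity for the orthogonal polynomials. -/
theorem hasSum_sq_div (h : OrdWeight p μ δ β γ) {i : ℕ} {f : ℤ → ℝ}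
    (hf : Summable fun j => wt p δ β γ i j * f j ^ 2) :
    HasSum (fun k => (∑' j, wt p δ β γ (i + k) j * diff k f j) ^ 2 /
        ((∏ r ∈ Finset.range k, gap δ (i + k) (i + r)) * ∑' j, wt p δ β γ (i + k) j))
      (∑' j, wt p δ β γ i j * f j ^ 2) := by
  have h1 := hasSum_weighted_sq_div (h.wt_nonneg i)
    (fun k (j : ℤ) => (ordPoly μ δ β γ i k).eval (j : ℝ)) (fun k => h.summable_wt_eval_sq i _)
    (fun k l hkl => h.tsum_ordPoly_mul i hkl) (fun f hf h0 j => h.wt_mul_eq_zero hf h0 j) hf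
  simpa only [h.tsum_ordPoly_sq, h.tsum_mul_ordPoly (h.mod_of_sq hf)] using h1

end OrdWeight

/-! ### Newton interpolation and the weights ν, κ -/

theorem gap_self (δ : ℝ) (k : ℕ) : gap δ k k = 0 := by simp [gap]

theorem gap_sub_gap (δ : ℝ) (a k i : ℕ) : gap δ a i - gap δ k i = gap δ a k := by
  simp only [gap]; ring

theorem nu_zero_right (δ : ℝ) (m n : ℕ) : nu δ m n 0 = 1 := by simp [nu]

/-- The recursion of the Newton coefficients when the zero λ_{m+n+1} is added and the value 1 at λ_0
is kept. -/
theorem nu_succ_succ {δ : ℝ} {m n i : ℕ} (hd : ∀ j ≤ m + n, 1 - (j : ℝ) * δ ≠ 0) (hi : i ≤ n) :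
    nu δ m (n + 1) (i + 1) * gap δ (m + n + 1) 0 =
      nu δ m n (i + 1) * gap δ (m + n + 1) (i + 1) + nu δ m n i := by
  have hP : ∀ l ≤ n + 1, ∏ j ∈ Finset.Ico m (m + l), (1 - (j : ℝ) * δ) ≠ 0 := fun l hl =>
    Finset.prod_ne_zero_iff.2 fun j hj => hd j (by have := (Finset.mem_Ico.1 hj).2; omega)
  have hPs : ∏ j ∈ Finset.Ico m (m + (i + 1)), (1 - (j : ℝ) * δ) =
      (∏ j ∈ Finset.Ico m (m + i), (1 - (j : ℝ) * δ)) * (1 - ((m : ℝ) + i) * δ) := by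
    rw [← add_assoc, Finset.prod_Ico_succ_top (by omega)]; push_cast; rfl
  have hPi := hP i (by omega)
  have hmi : 1 - ((m : ℝ) + i) * δ ≠ 0 := by exact_mod_cast hd (m + i) (by omega)
  have hmn : 1 - ((m : ℝ) + n) * δ ≠ 0 := by exact_mod_cast hd (m + n) le_rfl
  have hD1 : ((m + (n + 1)).descFactorial (i + 1) : ℝ) =
      ((m : ℝ) + n + 1) * ((m + n).descFactorial i : ℝ) := by
    rw [← add_assoc, Nat.succ_descFactorial_succ]; push_cast; ring
  have hD0 : ((m + n).descFactorial i : ℝ) ≠ 0 := by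
    exact_mod_cast (Nat.descFactorial_pos.2 (by omega : i ≤ m + n)).ne'
  have hN : (m : ℝ) + n + 1 ≠ 0 := by positivity
  have hch : ((n + 1).choose (i + 1) : ℝ) = n.choose i + n.choose (i + 1) := by
    rw [Nat.choose_succ_succ]; push_cast; ring
  have hab : (n.choose (i + 1) : ℝ) * (i + 1) = n.choose i * ((n : ℝ) - i) := by
    have := Nat.choose_succ_right_eq n i
    rw [← Nat.cast_sub hi]
    exact_mod_cast this
  -- The case i = n is separate: ν_{n+1} vanishes through its binomial, while m + n - i may be zero.
  rcases hi.eq_or_lt with rfl | hlt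
  · have h0 : nu δ m i (i + 1) = 0 := by simp [nu]
    rw [h0, zero_mul, zero_add, nu, nu, hD1, hPs]
    simp only [gap, Nat.choose_self]
    generalize ∏ j ∈ Finset.Ico m (m + i), (1 - (j : ℝ) * δ) = Q at hPi ⊢
    push_cast
    field_simp
    ring
  · have hD2 : ((m + n).descFactorial (i + 1) : ℝ) =
        ((m : ℝ) + n - i) * ((m + n).descFactorial i : ℝ) := by
      rw [Nat.descFactorial_succ, Nat.cast_mul, Nat.cast_sub (by omega)]; push_cast; ring
    have hNi : (m : ℝ) + n - i ≠ 0 := by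
      have : (i : ℝ) < n := by exact_mod_cast hlt
      have : (0 : ℝ) ≤ m := Nat.cast_nonneg m
      linarith
    rw [nu, nu, nu, hD1, hD2, hPs, hch]
    simp only [gap]
    generalize ∏ j ∈ Finset.Ico m (m + i), (1 - (j : ℝ) * δ) = Q at hPi ⊢
    push_cast
    field_simp
    linear_combination δ * (m + n + 1) * (m + n - i) * hab

/-- Newton's interpolation formula for the polynomial with zeros `λ_{m+1}, …, λ_{m+n}`. -/
theorem sum_nu_mul_prod_gap {δ : ℝ} {m n : ℕ} (hd : ∀ j < m + n, 1 - (j : ℝ) * δ ≠ 0) (k : ℕ) :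
    ∑ i ∈ Finset.range (n + 1), (-1 : ℝ) ^ i * nu δ m n i * ∏ r ∈ Finset.range i, gap δ k r =
      ∏ l ∈ Finset.range n, (gap δ (m + l + 1) k / gap δ (m + l + 1) 0) := by
  induction n with
  | zero => simp [nu]
  | succ n ih =>
    have hg : gap δ (m + n + 1) 0 ≠ 0 := by
      have h1 := hd (m + n) (by omega)
      have h2 : (m : ℝ) + n + 1 ≠ 0 := by positivity
      simp only [gap]
      push_cast at h1 ⊢
      refine mul_ne_zero (by simpa using h2) ?_
      convert h1 using 2
      ring
    rw [Finset.prod_range_succ, ← ih fun j hj => hd j (by omega), mul_div_assoc',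
      eq_div_iff hg, Finset.sum_mul]
    -- The new factor is split as (λ_{m+n+1} - λ_i) - (λ_k - λ_i); the second part extends the
    -- Newton product.
    have e1 : ∀ i, (-1 : ℝ) ^ i * nu δ m n i * (∏ r ∈ Finset.range i, gap δ k r) *
        gap δ (m + n + 1) k =
        (-1 : ℝ) ^ i * nu δ m n i * gap δ (m + n + 1) i * (∏ r ∈ Finset.range i, gap δ k r) +
        (-1 : ℝ) ^ (i + 1) * nu δ m n i * ∏ r ∈ Finset.range (i + 1), gap δ k r := by
      intro i
      rw [← gap_sub_gap δ (m + n + 1) k i, Finset.prod_range_succ]; ring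
    rw [Finset.sum_mul, Finset.sum_congr rfl fun i _ => e1 i, Finset.sum_add_distrib]
    have e2 : ∑ i ∈ Finset.range (n + 1), (-1 : ℝ) ^ i * nu δ m n i * gap δ (m + n + 1) i *
        (∏ r ∈ Finset.range i, gap δ k r) = gap δ (m + n + 1) 0 +
        ∑ i ∈ Finset.range (n + 1), (-1 : ℝ) ^ (i + 1) * nu δ m n (i + 1) *
          gap δ (m + n + 1) (i + 1) * (∏ r ∈ Finset.range (i + 1), gap δ k r) := by
      have h0 : nu δ m n (n + 1) = 0 := by simp [nu]
      rw [Finset.sum_range_succ' _ n, Finset.sum_range_succ _ n, h0]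
      simp [nu_zero_right]
      ring
    rw [e2, add_assoc (gap δ (m + n + 1) 0), ← Finset.sum_add_distrib, Finset.sum_range_succ',
      add_comm]
    congr 1
    · simp [nu_zero_right]
    · refine Finset.sum_congr rfl fun i hi => ?_
      have h1 := nu_succ_succ (δ := δ) (m := m) (n := n) (i := i) (fun j hj => hd j (by omega))
        (by have := Finset.mem_range.1 hi; omega)
      linear_combination ((-1 : ℝ) ^ (i + 1) * ∏ r ∈ Finset.range (i + 1), gap δ k r) * h1

theorem prod_div_eq_choose_mul_factorial_div {m i : ℕ} (hi : i ≤ m) (n : ℕ) :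
    ∏ l ∈ Finset.range n, (((m : ℝ) + l + 1 - i) / ((m : ℝ) + l + 1)) =
      (m.choose i : ℝ) * (i.factorial : ℝ) / ((m + n).descFactorial i : ℝ) := by
  have hD : ∀ n, ((m + n).descFactorial i : ℝ) ≠ 0 := fun n => by
    exact_mod_cast (Nat.descFactorial_pos.2 (by omega : i ≤ m + n)).ne'
  induction n with
  | zero =>
    rw [Finset.prod_range_zero, eq_comm, div_eq_one_iff_eq (hD 0), add_zero,
      Nat.descFactorial_eq_factorial_mul_choose]
    push_cast; ring
  | succ n ih =>
    have h1 := Nat.succ_descFactorial (m + n) i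
    have h2 : (((m : ℝ) + n + 1) - i) * ((m + (n + 1)).descFactorial i : ℝ) =
        ((m : ℝ) + n + 1) * ((m + n).descFactorial i : ℝ) := by
      have h3 : (((m + n + 1 - i : ℕ)) : ℝ) = (m : ℝ) + n + 1 - i := by
        rw [Nat.cast_sub (by omega)]; push_cast; ring
      rw [← h3]
      exact_mod_cast h1
    have hN : (m : ℝ) + n + 1 ≠ 0 := by positivity
    have := hD n
    have := hD (n + 1)
    rw [Finset.prod_range_succ, ih]
    field_simp
    linear_combination (m.choose i : ℝ) * h2

/-- The closed form of the weights `κ_i`. -/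
theorem kappa_closed_form {δ E : ℝ} {m n i : ℕ} (hi0 : 1 ≤ i) (hi : i ≤ m) :
    ((m.choose i : ℝ) * ∏ j ∈ Finset.Ico (m + i) (m + n + i), (1 - (j : ℝ) * δ)) /
    (((m + n).descFactorial i : ℝ) * E *
      (∏ j ∈ Finset.Ico (i - 1) (2 * i - 1), (1 - (j : ℝ) * δ)) *
      ∏ j ∈ Finset.Ico m (m + n), (1 - (j : ℝ) * δ)) =
    (∏ l ∈ Finset.range n, (gap δ (m + l + 1) i / gap δ (m + l + 1) 0)) /
      ((∏ r ∈ Finset.range i, gap δ i r) * E) := by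
  obtain ⟨a, rfl⟩ : ∃ a, i = a + 1 := ⟨i - 1, by omega⟩
  have h1 : ∏ l ∈ Finset.range n, (gap δ (m + l + 1) (a + 1) / gap δ (m + l + 1) 0) =
      (∏ l ∈ Finset.range n, (((m : ℝ) + l + 1 - (a + 1 : ℕ)) / ((m : ℝ) + l + 1))) *
        ((∏ j ∈ Finset.Ico (m + (a + 1)) (m + n + (a + 1)), (1 - (j : ℝ) * δ)) /
          ∏ j ∈ Finset.Ico m (m + n), (1 - (j : ℝ) * δ)) := by
    rw [Finset.prod_Ico_eq_prod_range, Finset.prod_Ico_eq_prod_range,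
      show m + n + (a + 1) - (m + (a + 1)) = n by omega, Nat.add_sub_cancel_left,
      ← Finset.prod_div_distrib, ← Finset.prod_mul_distrib]
    refine Finset.prod_congr rfl fun l _ => ?_
    rw [div_mul_div_comm, gap, gap]
    push_cast
    congr 2 <;> ring
  have h2 : ∏ r ∈ Finset.range (a + 1), gap δ (a + 1) r =
      ((a + 1).factorial : ℝ) *
        ∏ j ∈ Finset.Ico (a + 1 - 1) (2 * (a + 1) - 1), (1 - (j : ℝ) * δ) := by
    rw [Finset.prod_Ico_eq_prod_range, show 2 * (a + 1) - 1 - (a + 1 - 1) = a + 1 by omega,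
      ← Finset.prod_range_add_one_eq_factorial, Nat.cast_prod,
      ← Finset.prod_range_reflect (fun r => ((r + 1 : ℕ) : ℝ)), ← Finset.prod_mul_distrib]
    refine Finset.prod_congr rfl fun r hr => ?_
    have hr := Finset.mem_range.1 hr
    have h3 : ((a + 1 - 1 - r + 1 : ℕ) : ℝ) = (a : ℝ) + 1 - r := by
      rw [Nat.add_sub_cancel, Nat.cast_add, Nat.cast_sub (by omega)]; push_cast; ring
    rw [h3, gap]
    push_cast [Nat.add_sub_cancel]
    ring
  rw [h1, h2, prod_div_eq_choose_mul_factorial_div hi]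
  have hf : ((a + 1).factorial : ℝ) ≠ 0 := by positivity
  generalize ∏ j ∈ Finset.Ico (m + (a + 1)) (m + n + (a + 1)), (1 - (j : ℝ) * δ) = A
  generalize ∏ j ∈ Finset.Ico m (m + n), (1 - (j : ℝ) * δ) = B
  generalize ∏ j ∈ Finset.Ico (a + 1 - 1) (2 * (a + 1) - 1), (1 - (j : ℝ) * δ) = D
  field_simp

/-! ### Spectral expansion of the variance and of its bound -/

namespace OrdWeight

theorem tsum_wt_pos_of_le (h : OrdWeight p μ δ β γ) {k l : ℕ} (hl : 0 < ∑' j, wt p δ β γ l j)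
    (hkl : k ≤ l) : 0 < ∑' j, wt p δ β γ k j := by
  induction l, hkl using Nat.le_induction with
  | base => exact hl
  | succ l hkl ih =>
    refine ih ?_
    by_contra h0
    refine hl.ne' ?_
    convert tsum_zero with j
    by_contra hj
    rw [wt_succ] at hj
    exact h0 (h.tsum_wt_pos_of_ne_zero (right_ne_zero_of_mul hj))

theorem wt_eq_zero (h : OrdWeight p μ δ β γ) {k : ℕ} (hk : ¬ 0 < ∑' j, wt p δ β γ k j) (j : ℤ) :
    wt p δ β γ k j = 0 := by
  by_contra hj
  exact hk (h.tsum_wt_pos_of_ne_zero hj)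

theorem prod_gap_pos (h : OrdWeight p μ δ β γ) {k : ℕ} (hk : 0 < ∑' j, wt p δ β γ k j) :
    0 < ∏ r ∈ Finset.range k, gap δ k r :=
  Finset.prod_pos fun _ hr => h.gap_pos hk (Finset.mem_range.1 hr)

/-- Summability of the squares of all differences of lower order. -/
theorem summable_diff_sq (h : OrdWeight p μ δ β γ) {n N : ℕ} (hN : 0 < ∑' j, wt p δ β γ N j)
    (hnN : n ≤ N) {g : ℤ → ℝ} (hg : Summable fun j => wt p δ β γ n j * diff n g j ^ 2) {i : ℕ}
    (hi : i ≤ n) : Summable fun j => wt p δ β γ i j * diff i g j ^ 2 := by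
  induction n, hi using Nat.le_induction with
  | base => exact hg
  | succ n hi ih =>
    refine ih (by omega) (h.summable_sq_of_summable_fwdDiff_sq ?_ ?_)
    · have h1 : (n : ℝ) + 1 ≤ N := by exact_mod_cast hnN
      exact h.one_sub_mul_pos hN (by positivity) (by linarith)
    · rwa [diff_succ] at hg

/-- The expansion of `E q^{[i]} (Δ^i g)²` in the coefficients of `g`. -/
theorem hasSum_diff_sq (h : OrdWeight p μ δ β γ) {g : ℤ → ℝ} {i : ℕ}
    (hg : Summable fun j => wt p δ β γ i j * diff i g j ^ 2) :
    HasSum (fun k => (∑' j, wt p δ β γ k j * diff k g j) ^ 2 /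
        ((∏ r ∈ Finset.range k, gap δ k r) * ∑' j, wt p δ β γ k j) *
          ∏ r ∈ Finset.range i, gap δ k r)
      (∑' j, wt p δ β γ i j * diff i g j ^ 2) := by
  -- Parseval at level i indexes by k - i; the missing terms k < i vanish because their product
  -- contains λ_k - λ_k.
  have h1 := h.hasSum_sq_div hg
  have h0 : ∑ k ∈ Finset.range i, ((∑' j, wt p δ β γ k j * diff k g j) ^ 2 /
        ((∏ r ∈ Finset.range k, gap δ k r) * ∑' j, wt p δ β γ k j) *
          ∏ r ∈ Finset.range i, gap δ k r) = 0 := by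
    refine Finset.sum_eq_zero fun k hk => ?_
    rw [Finset.prod_eq_zero hk (gap_self δ k), mul_zero]
  rw [← add_zero (∑' j, wt p δ β γ i j * diff i g j ^ 2), ← h0, ← hasSum_nat_add_iff]
  refine (congrArg (HasSum · _) (funext fun k => ?_)).mpr h1
  rw [diff_diff, add_comm k i]
  by_cases hE : 0 < ∑' j, wt p δ β γ (i + k) j
  · have h2 := (h.prod_gap_pos hE).ne'
    rw [Finset.prod_range_add] at h2 ⊢
    have h3 := left_ne_zero_of_mul h2
    have h4 := right_ne_zero_of_mul h2
    have h5 := hE.ne'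
    field_simp
  · simp [h.wt_eq_zero hE]

/-- The coefficients of order larger than `N` vanish exactly for the polynomials of degree at most
`N`. -/
theorem forall_tsum_diff_eq_zero_iff (h : OrdWeight p μ δ β γ) {g : ℤ → ℝ} {N : ℕ}
    (hN : 0 < ∑' j, wt p δ β γ N j) (hg : Summable fun j => p j * g j ^ 2) :
    (∀ k, N < k → ∑' j, wt p δ β γ k j * diff k g j = 0) ↔
      ∃ H : ℝ[X], H.natDegree ≤ N ∧ ∀ j : ℤ, 0 < p j → g j = H.eval (j : ℝ) := by
  have hg0 : Summable fun j => wt p δ β γ 0 j * g j ^ 2 := by simpa using hg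
  have hmg := h.mod_of_sq hg0
  have hcoef : ∀ {u : ℤ → ℝ}, Mod (wt p δ β γ 0) u → ∀ k,
      ∑' j : ℤ, wt p δ β γ 0 j * (u j * (ordPoly μ δ β γ 0 k).eval (j : ℝ)) =
        ∑' j, wt p δ β γ k j * diff k u j := by
    intro u hu k
    have := h.tsum_mul_ordPoly hu k
    rwa [zero_add] at this
  constructor
  · intro hb
    set c : ℕ → ℝ := fun k => (∑' j, wt p δ β γ k j * diff k g j) /
      ((∏ r ∈ Finset.range k, gap δ k r) * ∑' j, wt p δ β γ k j) with hc
    -- The orthogonal projection of g; g - H is orthogonal to every polynomial of the family, hence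
    -- zero on the support.
    set H : ℝ[X] := ∑ k ∈ Finset.range (N + 1), C (c k) * ordPoly μ δ β γ 0 k with hH
    have hHdeg : H.natDegree ≤ N := by
      refine natDegree_sum_le_of_forall_le _ _ fun k hk => ?_
      have hk := Finset.mem_range.1 hk
      exact (natDegree_C_mul_le _ _).trans ((natDegree_ordPoly_le 0 k).trans (by omega))
    refine ⟨H, hHdeg, fun j hj => ?_⟩
    have hmf : Mod (wt p δ β γ 0) fun j => g j - H.eval (j : ℝ) := hmg.sub (h.mod_eval 0 H)
    have hfs : Summable fun j : ℤ => wt p δ β γ 0 j * (g j - H.eval (j : ℝ)) ^ 2 := by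
      refine Summable.of_nonneg_of_le
        (fun j => mul_nonneg (h.wt_nonneg 0 j) (sq_nonneg _)) (fun j => ?_)
        ((hg0.mul_left 2).add ((h.summable_wt_eval_sq 0 H).mul_left 2))
      have h1 : (g j - H.eval (j : ℝ)) ^ 2 ≤ 2 * g j ^ 2 + 2 * H.eval (j : ℝ) ^ 2 := by
        nlinarith [sq_nonneg (g j + H.eval (j : ℝ))]
      nlinarith [mul_le_mul_of_nonneg_left h1 (h.wt_nonneg 0 j)]
    have h0 : ∀ k, ∑' j : ℤ, wt p δ β γ 0 j *
        ((g j - H.eval (j : ℝ)) * (ordPoly μ δ β γ 0 k).eval (j : ℝ)) = 0 := by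
      intro k
      have e1 : ∀ j : ℤ, wt p δ β γ 0 j *
          ((g j - H.eval (j : ℝ)) * (ordPoly μ δ β γ 0 k).eval (j : ℝ)) =
          wt p δ β γ 0 j * (g j * (ordPoly μ δ β γ 0 k).eval (j : ℝ)) -
          ∑ l ∈ Finset.range (N + 1), c l * (wt p δ β γ 0 j *
            ((ordPoly μ δ β γ 0 l).eval (j : ℝ) * (ordPoly μ δ β γ 0 k).eval (j : ℝ))) := by
        intro j
        rw [hH, eval_finsetSum, sub_mul, mul_sub, Finset.sum_mul, Finset.mul_sum]
        congr 1
        refine Finset.sum_congr rfl fun l _ => ?_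
        rw [eval_mul, eval_C]; ring
      have hsl : ∀ l, Summable fun j : ℤ => wt p δ β γ 0 j *
            ((ordPoly μ δ β γ 0 l).eval (j : ℝ) * (ordPoly μ δ β γ 0 k).eval (j : ℝ)) :=
        fun l => h.mod_eval 0 _ _
      rw [tsum_congr e1, (hmg _).tsum_sub (summable_sum fun l _ => (hsl l).mul_left _),
        Summable.tsum_finsetSum fun l _ => (hsl l).mul_left _, hcoef hmg]
      simp only [tsum_mul_left]
      rcases Nat.lt_or_ge N k with hk | hk
      · rw [hb k hk, Finset.sum_eq_zero fun l hl => ?_, sub_zero]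
        have := Finset.mem_range.1 hl
        rw [h.tsum_ordPoly_mul 0 (by omega), mul_zero]
      · rw [Finset.sum_eq_single k (fun l _ hl => by rw [h.tsum_ordPoly_mul 0 hl, mul_zero])
          (fun hk' => absurd (Finset.mem_range.2 (by omega)) hk'), h.tsum_ordPoly_sq]
        have hE := h.tsum_wt_pos_of_le hN hk
        have h2 := (h.prod_gap_pos hE).ne'
        have h3 := hE.ne'
        simp only [hc, zero_add]
        field_simp
        ring
    have := h.wt_mul_eq_zero hfs h0 j
    rw [wt_zero] at this
    linarith [(mul_eq_zero.1 this).resolve_left hj.ne']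
  · rintro ⟨H, hH, hgH⟩ k hk
    have e1 : ∑' j, wt p δ β γ k j * diff k g j =
        ∑' j, wt p δ β γ k j * diff k (fun j : ℤ => H.eval (j : ℝ)) j := by
      rw [← hcoef hmg, ← hcoef (h.mod_eval 0 H)]
      refine tsum_congr fun j => ?_
      rw [wt_zero]
      rcases (h.nonneg j).eq_or_lt with hj | hj
      · simp [← hj]
      · rw [hgH j hj]
    rw [e1, ← hcoef (h.mod_eval 0 H)]
    obtain ⟨c, hc⟩ := h.exists_eq_sum_ordPoly N 0 hH
    have e2 : ∀ j : ℤ, wt p δ β γ 0 j * (H.eval (j : ℝ) * (ordPoly μ δ β γ 0 k).eval (j : ℝ)) =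
        ∑ l ∈ Finset.range (N + 1), c l * (wt p δ β γ 0 j *
          ((ordPoly μ δ β γ 0 l).eval (j : ℝ) * (ordPoly μ δ β γ 0 k).eval (j : ℝ))) := by
      intro j
      by_cases hj : wt p δ β γ 0 j = 0
      · simp [hj]
      rw [hc j hj, Finset.sum_mul, Finset.mul_sum]
      exact Finset.sum_congr rfl fun l _ => by ring
    rw [tsum_congr e2, Summable.tsum_finsetSum fun l _ => Summable.mul_left _ (h.mod_eval 0 _ _)]
    refine Finset.sum_eq_zero fun l hl => ?_
    have := Finset.mem_range.1 hl
    rw [tsum_mul_left, h.tsum_ordPoly_mul 0 (by omega), mul_zero]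

end OrdWeight

namespace OrdWeight

/-- The expansion of the difference between the variance and its bound. -/
theorem hasSum_remainder (h : OrdWeight p μ δ β γ) (hp : ∑' j, p j = 1) {m n : ℕ} (hn : n ≠ 0)
    (hN : 0 < ∑' j, wt p δ β γ (m + n) j) {g : ℤ → ℝ}
    (hg : Summable fun j => wt p δ β γ n j * diff n g j ^ 2) :
    HasSum (fun k => (∑' j, wt p δ β γ (k + (m + n + 1)) j * diff (k + (m + n + 1)) g j) ^ 2 /
        ((∏ r ∈ Finset.range (k + (m + n + 1)), gap δ (k + (m + n + 1)) r) *
          ∑' j, wt p δ β γ (k + (m + n + 1)) j) *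
        ∏ l ∈ Finset.range n, (gap δ (m + l + 1) (k + (m + n + 1)) / gap δ (m + l + 1) 0))
      (∑' j, p j * g j ^ 2 - (∑' j, p j * g j) ^ 2 -
        (∑ i ∈ Finset.Icc 1 m, (∏ l ∈ Finset.range n, (gap δ (m + l + 1) i / gap δ (m + l + 1) 0)) /
            ((∏ r ∈ Finset.range i, gap δ i r) * ∑' j, wt p δ β γ i j) *
            (∑' j, wt p δ β γ i j * diff i g j) ^ 2 +
          ∑ i ∈ Finset.Icc 1 n, (-1 : ℝ) ^ (i - 1) * nu δ m n i *
            ∑' j, wt p δ β γ i j * diff i g j ^ 2)) := by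
  set b : ℕ → ℝ := fun k => ∑' j, wt p δ β γ k j * diff k g j with hb
  set H : ℕ → ℝ := fun k => (∏ r ∈ Finset.range k, gap δ k r) * ∑' j, wt p δ β γ k j with hH
  set R : ℕ → ℝ := fun k => ∏ l ∈ Finset.range n, (gap δ (m + l + 1) k / gap δ (m + l + 1) 0)
    with hR
  set T : ℕ → ℝ := fun i => ∑' j, wt p δ β γ i j * diff i g j ^ 2 with hT
  have hd : ∀ j < m + n, 1 - (j : ℝ) * δ ≠ 0 := by
    intro j hj
    have h1 : (j : ℝ) + 1 ≤ (m + n : ℕ) := by exact_mod_cast hj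
    have h2 : (1 : ℝ) ≤ (m + n : ℕ) := by
      exact_mod_cast (Nat.one_le_iff_ne_zero.2 hn).trans (Nat.le_add_left n m)
    exact (h.one_sub_mul_pos hN (Nat.cast_nonneg j) (by linarith)).ne'
  have h1 : HasSum (fun k => b k ^ 2 / H k * R k)
      (∑ i ∈ Finset.range (n + 1), (-1 : ℝ) ^ i * nu δ m n i * T i) := by
    have h2 := hasSum_sum (s := Finset.range (n + 1)) fun i hi =>
      (h.hasSum_diff_sq (h.summable_diff_sq hN (Nat.le_add_left n m) hg
        (Nat.lt_succ_iff.1 (Finset.mem_range.1 hi)))).mul_left ((-1 : ℝ) ^ i * nu δ m n i)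
    refine (congrArg (HasSum · _) (funext fun k => ?_)).mpr h2
    simp only [hR]
    rw [← sum_nu_mul_prod_gap hd, Finset.mul_sum]
    exact Finset.sum_congr rfl fun i _ => by ring
  have h2 := (hasSum_nat_add_iff' (m + n + 1)).2 h1
  have hR0 : R 0 = 1 := by
    refine Finset.prod_eq_one fun l hl => div_self ?_
    exact (h.gap_pos (h.tsum_wt_pos_of_le hN (by have := Finset.mem_range.1 hl; omega))
      (by omega)).ne'
  have hH0 : H 0 = 1 := by simp [hH, hp]
  have hb0 : b 0 = ∑' j, p j * g j := by simp [hb, diff]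
  have hT0 : T 0 = ∑' j, p j * g j ^ 2 := by simp [hT, diff]
  -- R vanishes at m < k ≤ m+n; k = 0 is the squared mean and the rest is the κ-sum.
  have h3 : ∑ k ∈ Finset.range (m + n + 1), b k ^ 2 / H k * R k =
      b 0 ^ 2 + ∑ i ∈ Finset.Icc 1 m, R i / H i * b i ^ 2 := by
    rw [← Finset.sum_subset (s₁ := Finset.range (m + 1)), Finset.sum_range_succ', add_comm, hR0, hH0,
      div_one, mul_one, ← Finset.Ico_add_one_right_eq_Icc, Finset.sum_Ico_eq_sum_range]
    · congr 1
      refine Finset.sum_congr rfl fun i _ => ?_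
      rw [add_comm 1 i]; ring
    · exact fun k hk => Finset.mem_range.2 (by have := Finset.mem_range.1 hk; omega)
    · intro k hk hk'
      rw [Finset.mem_range] at hk hk'
      have : R k = 0 := by
        refine Finset.prod_eq_zero (i := k - m - 1) (Finset.mem_range.2 (by omega)) ?_
        rw [show m + (k - m - 1) + 1 = k by omega, gap_self, zero_div]
      rw [this, mul_zero]
  have h4 : ∑ i ∈ Finset.range (n + 1), (-1 : ℝ) ^ i * nu δ m n i * T i =
      T 0 - ∑ i ∈ Finset.Icc 1 n, (-1 : ℝ) ^ (i - 1) * nu δ m n i * T i := by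
    rw [Finset.sum_range_succ', nu_zero_right, ← Finset.Ico_add_one_right_eq_Icc,
      Finset.sum_Ico_eq_sum_range, Nat.add_sub_cancel, add_comm, sub_eq_add_neg,
      ← Finset.sum_neg_distrib]
    congr 1
    · simp
    · refine Finset.sum_congr rfl fun i _ => ?_
      rw [add_comm 1 i, Nat.add_sub_cancel, pow_succ]; ring
  rw [h3, h4, hT0, hb0] at h2
  exact (congrArg (fun a => HasSum _ a) (by ring)).mpr h2

/-- The remainder terms have the sign `(-1)^n`. -/
theorem remainder_factor_pos (h : OrdWeight p μ δ β γ) {m n k : ℕ}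
    (hN : 0 < ∑' j, wt p δ β γ (m + n) j) (hk : 0 < ∑' j, wt p δ β γ k j) (hmn : m + n < k) :
    0 < (-1 : ℝ) ^ n *
      ∏ l ∈ Finset.range n, (gap δ (m + l + 1) k / gap δ (m + l + 1) 0) := by
  have e : (-1 : ℝ) ^ n = ∏ _l ∈ Finset.range n, (-1 : ℝ) := by simp
  rw [e, ← Finset.prod_mul_distrib]
  refine Finset.prod_pos fun l hl => ?_
  have hl := Finset.mem_range.1 hl
  have h1 : 0 < gap δ (m + l + 1) 0 := h.gap_pos (h.tsum_wt_pos_of_le hN (by omega)) (by omega)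
  have h2 : 0 < gap δ k (m + l + 1) := h.gap_pos hk (by omega)
  have h3 : -1 * (gap δ (m + l + 1) k / gap δ (m + l + 1) 0) =
      gap δ k (m + l + 1) / gap δ (m + l + 1) 0 := by
    simp only [gap]; ring
  rw [h3]
  exact div_pos h2 h1

theorem kappa_factor_pos (h : OrdWeight p μ δ β γ) {m n i : ℕ}
    (hN : 0 < ∑' j, wt p δ β γ (m + n) j) (hi : i ≤ m) :
    0 < (∏ l ∈ Finset.range n, (gap δ (m + l + 1) i / gap δ (m + l + 1) 0)) /
      ((∏ r ∈ Finset.range i, gap δ i r) * ∑' j, wt p δ β γ i j) := by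
  have hE := h.tsum_wt_pos_of_le hN (show i ≤ m + n by omega)
  refine div_pos (Finset.prod_pos fun l hl => ?_) (mul_pos (h.prod_gap_pos hE) hE)
  have hl := Finset.mem_range.1 hl
  have hE' := h.tsum_wt_pos_of_le hN (show m + l + 1 ≤ m + n by omega)
  exact div_pos (h.gap_pos hE' (by omega)) (h.gap_pos hE' (by omega))

theorem nu_pos (h : OrdWeight p μ δ β γ) {m n i : ℕ}
    (hN : 0 < ∑' j, wt p δ β γ (m + n) j) (hi0 : 1 ≤ i) (hi : i ≤ n) : 0 < nu δ m n i := by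
  have h1 : (0 : ℝ) < n.choose i := by exact_mod_cast Nat.choose_pos hi
  have h2 : (0 : ℝ) < (m + n).descFactorial i := by
    exact_mod_cast Nat.descFactorial_pos.2 (by omega)
  refine div_pos h1 (mul_pos h2 (Finset.prod_pos fun j hj => ?_))
  have hj := (Finset.mem_Ico.1 hj).2
  have h3 : (j : ℝ) + 1 ≤ (m + n : ℕ) := by exact_mod_cast (by omega : j + 1 ≤ m + n)
  have h4 : (1 : ℝ) ≤ (m + n : ℕ) := by exact_mod_cast (by omega : 1 ≤ m + n)
  exact h.one_sub_mul_pos hN (Nat.cast_nonneg j) (by linarith)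

end OrdWeight

theorem hasSum_sign {a R : ℕ → ℝ} {s D : ℝ} (hsum : HasSum (fun k => a k * R k) D)
    (ha : ∀ k, 0 ≤ a k) (hR : ∀ k, a k ≠ 0 → 0 < s * R k) :
    0 ≤ s * D ∧ (D = 0 ↔ ∀ k, a k = 0) := by
  have h1 := hsum.mul_left s
  have h2 : ∀ k, 0 ≤ s * (a k * R k) := by
    intro k
    by_cases hk : a k = 0
    · simp [hk]
    · rw [mul_left_comm]; exact mul_nonneg (ha k) (hR k hk).le
  refine ⟨h1.nonneg h2, fun h0 k => ?_, fun h0 => ?_⟩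
  · rw [h0, mul_zero] at h1
    have h3 := congrFun ((hasSum_zero_iff_of_nonneg h2).1 h1) k
    by_contra hk
    have := mul_pos (lt_of_le_of_ne (ha k) (Ne.symm hk)) (hR k hk)
    rw [mul_left_comm] at this
    exact this.ne' h3
  · refine hsum.unique ?_
    simp [h0, hasSum_zero]

/-! ### From random variables to weighted sequences -/

section Bridge

variable {Ω : Type*} [MeasurableSpace Ω] {P : Measure Ω} {X : Ω → ℤ}

theorem pmf_eq_map (hX : Measurable X) (j : ℤ) : pmf P X j = (P.map X).real {j} := by
  rw [pmf, map_measureReal_apply hX (measurableSet_singleton j)]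

/-- N + 1 points of the support span at least N steps, and the support is an interval, so q^{[N]}p
is positive at the leftmost of them. -/
theorem tsum_wt_pos_of_le_bigM (h : OrdWeight (pmf P X) μ δ β γ) {N : ℕ} (hN : N ≠ 0)
    (hM : (N : ℕ∞) ≤ bigM P X) : 0 < ∑' j, wt (pmf P X) δ β γ N j := by
  have h1 : ((N + 1 : ℕ) : ℕ∞) ≤ (support P X).encard := by
    -- The subtraction in `bigM` is truncated; N ≠ 0 ensures that it can be undone.
    have h0 : (0 : ℕ∞) < (support P X).encard - 1 :=
      lt_of_lt_of_le (by exact_mod_cast Nat.pos_of_ne_zero hN) hM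
    have h2 := tsub_pos_iff_lt.1 h0
    push_cast
    calc (N : ℕ∞) + 1 ≤ (support P X).encard - 1 + 1 := by gcongr; exact hM
      _ = _ := tsub_add_cancel_of_le h2.le
  obtain ⟨t, hts, htc⟩ := Set.exists_subset_encard_eq h1
  have htf : t.Finite := Set.finite_of_encard_eq_coe htc
  lift t to Finset ℤ using htf
  rw [Set.encard_coe_eq_coe_finsetCard] at htc
  have hcard : t.card = N + 1 := by exact_mod_cast htc
  have hne : t.Nonempty := Finset.card_pos.1 (by omega)
  have hsub : t ⊆ Finset.Icc (t.min' hne) (t.max' hne) := fun x hx =>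
    Finset.mem_Icc.2 ⟨t.min'_le x hx, t.le_max' x hx⟩
  have hle := Finset.card_le_card hsub
  rw [hcard, Int.card_Icc] at hle
  have ha : 0 < pmf P X (t.min' hne) := hts (t.min'_mem hne)
  have hb : 0 < pmf P X (t.max' hne) := hts (t.max'_mem hne)
  exact h.tsum_wt_pos_of_ne_zero (j := t.min' hne)
    (h.wt_pos ha (h.pos_of_mem ha hb (by omega) (by omega))).ne'

variable [IsProbabilityMeasure P]

theorem integrable_comp_iff (hX : Measurable X) (f : ℤ → ℝ) :
    Integrable (fun ω => f (X ω)) P ↔ Summable fun j => pmf P X j * f j := by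
  have h1 : Integrable (fun ω => f (X ω)) P ↔ Integrable f (P.map X) :=
    (integrable_map_measure (Measurable.of_discrete.aestronglyMeasurable) hX.aemeasurable).symm
  rw [h1, ← Measure.sum_smul_dirac (P.map X), integrable_sum_dirac_iff (by simp),
    ← summable_norm_iff (f := fun j => pmf P X j * f j)]
  refine summable_congr fun j => ?_
  rw [norm_mul, pmf_eq_map hX, Real.norm_of_nonneg measureReal_nonneg]
  rfl

theorem integral_comp_eq_tsum (hX : Measurable X) (f : ℤ → ℝ) :
    ∫ ω, f (X ω) ∂P = ∑' j, pmf P X j * f j := by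
  by_cases hf : Integrable (fun ω => f (X ω)) P
  · have h1 : ∫ ω, f (X ω) ∂P = ∫ j, f j ∂(P.map X) :=
      (integral_map hX.aemeasurable Measurable.of_discrete.aestronglyMeasurable).symm
    rw [h1, integral_countable ((integrable_map_measure
      Measurable.of_discrete.aestronglyMeasurable hX.aemeasurable).2 hf)]
    exact tsum_congr fun j => by rw [pmf_eq_map hX, smul_eq_mul]
  · rw [integral_undef hf, tsum_eq_zero_of_not_summable]
    rwa [← integrable_comp_iff hX]

theorem tsum_pmf (hX : Measurable X) : ∑' j, pmf P X j = 1 := by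
  have := integral_comp_eq_tsum (P := P) hX fun _ => 1
  simpa using this.symm

theorem IsCO.ordWeight (h : IsCO P X μ δ β γ) (hδ : δ ≤ 0 ∨ (support P X).Finite) :
    OrdWeight (pmf P X) μ δ β γ := by
  have hp : ∀ j, 0 ≤ pmf P X j := fun j => measureReal_nonneg
  set c : ℤ → ℝ := fun k => (μ - k) * pmf P X k with hc
  have hp1 : Summable fun j => pmf P X j * 1 :=
    (integrable_comp_iff h.measurable fun _ => 1).1 (integrable_const 1)
  have hpj : Summable fun j : ℤ => pmf P X j * j :=
    (integrable_comp_iff h.measurable fun j => (j : ℝ)).1 h.integrable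
  have hcs : Summable c := ((hp1.mul_left μ).sub hpj).congr fun j => by simp only [hc]; ring
  have hc0 : ∑' j, c j = 0 := by
    have h1 : ∀ j : ℤ, c j = μ * (pmf P X j * 1) - pmf P X j * j := fun j => by
      simp only [hc]; ring
    rw [tsum_congr h1, (hp1.mul_left μ).tsum_sub hpj, tsum_mul_left]
    have h2 := integral_comp_eq_tsum (P := P) h.measurable fun j => (j : ℝ)
    rw [← h2, h.mean_eq]
    simp [tsum_pmf h.measurable]
  have hF : ∀ j, ∑' k : Set.Iic j, c k = quad δ β γ j * pmf P X j := h.sum_eq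
  have hdiff : ∀ j, quad δ β γ j * pmf P X j - quad δ β γ (j - 1) * pmf P X (j - 1) =
      (μ - j) * pmf P X j := by
    intro j
    have h1 : Set.Iic j = Set.Iic (j - 1) ∪ {j} := by
      ext k; simp only [Set.mem_Iic, Set.mem_union, Set.mem_singleton_iff]; omega
    have h2 : Disjoint (Set.Iic (j - 1)) {j} := by simp
    rw [← hF, ← hF, h1, (hcs.subtype _).tsum_union_disjoint h2 (hcs.subtype _), tsum_singleton,
      add_sub_cancel_left]
  have hq : ∀ j, 0 ≤ quad δ β γ j * pmf P X j := by
    intro j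
    rw [← hF]
    rcases le_or_gt (j : ℝ) μ with hj | hj
    · refine tsum_nonneg fun k => mul_nonneg ?_ (hp _)
      have : ((k : ℤ) : ℝ) ≤ j := by exact_mod_cast k.2
      linarith
    -- Beyond μ the sign is read from the complementary tail, since the total sum is zero.
    · have h1 := hcs.tsum_subtype_add_tsum_subtype_compl (Set.Iic j)
      rw [hc0] at h1
      have h2 : ∑' k : ↥(Set.Iic j)ᶜ, c k ≤ 0 := by
        refine tsum_nonpos fun k => mul_nonpos_of_nonpos_of_nonneg ?_ (hp _)
        have : (j : ℝ) ≤ ((k : ℤ) : ℝ) := by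
          have := k.2
          rw [Set.mem_compl_iff, Set.mem_Iic, not_le] at this
          exact_mod_cast this.le
        linarith
      linarith
  refine ⟨hp, hq, fun j => by linear_combination hdiff j, ?_⟩
  rcases hδ with hδ | hfin
  · exact exists_summable_mul_exp hp hq hdiff hδ
  · refine ⟨1, one_pos, summable_of_hasFiniteSupport (hfin.subset fun j hj => ?_)⟩
    exact lt_of_le_of_ne (hp j) (Ne.symm (left_ne_zero_of_mul hj))

end Bridge

end CumOrd

end

theorem mainTheorem1 {Ω : Type*} [MeasurableSpace Ω] (P : Measure Ω) [IsProbabilityMeasure P]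
    (X : Ω → ℤ) (μ δ β γ : ℝ) (hX : CumOrd.InClassC P X μ δ β γ)
    (m n : ℕ) (hn : n ≠ 0) (hM : ((m + n : ℕ) : ℕ∞) ≤ CumOrd.bigM P X)
    (g : ℤ → ℝ) (hg : CumOrd.MemH P X δ β γ m n g) :
    -- all the expectations in the statement are finite
    MemLp (fun ω => g (X ω)) 2 P ∧
    (∀ i ≤ m, Integrable (fun ω => CumOrd.ascPow (CumOrd.quad δ β γ) i (X ω)) P ∧
      Integrable (fun ω =>
        CumOrd.ascPow (CumOrd.quad δ β γ) i (X ω) * CumOrd.diff i g (X ω)) P) ∧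
    (∀ i ≤ n, Integrable (fun ω =>
        CumOrd.ascPow (CumOrd.quad δ β γ) i (X ω) * (CumOrd.diff i g (X ω)) ^ 2) P) ∧
    -- the weights are strictly positive
    (∀ i, 1 ≤ i → i ≤ m → 0 < CumOrd.kappa P X δ β γ m n i) ∧
    (∀ i, 1 ≤ i → i ≤ n → 0 < CumOrd.nu δ m n i) ∧
    -- the variance inequality
    0 ≤ (-1 : ℝ) ^ n *
      (ProbabilityTheory.variance (fun ω => g (X ω)) P - CumOrd.boundS P X δ β γ m n g) ∧
    -- the case of equality
    (CumOrd.boundS P X δ β γ m n g = ProbabilityTheory.variance (fun ω => g (X ω)) P ↔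
      ∃ H : Polynomial ℝ, H.natDegree ≤ m + n ∧
        ∀ j ∈ CumOrd.support P X, g j = H.eval (j : ℝ)) := by
  have hm := hX.1.measurable
  have h := hX.1.ordWeight hX.2
  have hN := CumOrd.tsum_wt_pos_of_le_bigM h (by omega) hM
  have hint : ∀ (i : ℕ) (f : ℤ → ℝ),
      Integrable (fun ω => CumOrd.ascPow (CumOrd.quad δ β γ) i (X ω) * f (X ω)) P ↔
        Summable fun j => CumOrd.wt (CumOrd.pmf P X) δ β γ i j * f j := by
    intro i f
    rw [CumOrd.integrable_comp_iff hm fun j => CumOrd.ascPow (CumOrd.quad δ β γ) i j * f j]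
    refine summable_congr fun j => ?_
    rw [CumOrd.wt]; ring
  have hval : ∀ (i : ℕ) (f : ℤ → ℝ),
      ∫ ω, CumOrd.ascPow (CumOrd.quad δ β γ) i (X ω) * f (X ω) ∂P =
        ∑' j, CumOrd.wt (CumOrd.pmf P X) δ β γ i j * f j := by
    intro i f
    rw [CumOrd.integral_comp_eq_tsum hm fun j => CumOrd.ascPow (CumOrd.quad δ β γ) i j * f j]
    refine tsum_congr fun j => ?_
    rw [CumOrd.wt]; ring
  have hE : ∀ i : ℕ, ∫ ω, CumOrd.ascPow (CumOrd.quad δ β γ) i (X ω) ∂P =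
      ∑' j, CumOrd.wt (CumOrd.pmf P X) δ β γ i j := by
    intro i
    simpa using hval i fun _ => 1
  have hgn := (hint n fun j => CumOrd.diff n g j ^ 2).1 hg.1
  have hgi : ∀ i ≤ n, Summable fun j =>
      CumOrd.wt (CumOrd.pmf P X) δ β γ i j * CumOrd.diff i g j ^ 2 :=
    fun i hi => h.summable_diff_sq hN (Nat.le_add_left n m) hgn hi
  have hg0 : Summable fun j => CumOrd.pmf P X j * g j ^ 2 := by
    simpa [CumOrd.diff] using hgi 0 (Nat.zero_le n)
  have hmod : CumOrd.Mod (CumOrd.wt (CumOrd.pmf P X) δ β γ 0) g :=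
    h.mod_of_sq (by simpa using hg0)
  have hL2 : MemLp (fun ω => g (X ω)) 2 P :=
    (memLp_two_iff_integrable_sq ((Measurable.of_discrete.comp hm).aestronglyMeasurable)).2
      ((CumOrd.integrable_comp_iff hm fun j => g j ^ 2).2 hg0)
  have hkappa : ∀ i, 1 ≤ i → i ≤ m → CumOrd.kappa P X δ β γ m n i =
      (∏ l ∈ Finset.range n, (CumOrd.gap δ (m + l + 1) i / CumOrd.gap δ (m + l + 1) 0)) /
        ((∏ r ∈ Finset.range i, CumOrd.gap δ i r) *
          ∑' j, CumOrd.wt (CumOrd.pmf P X) δ β γ i j) := by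
    intro i hi0 hi
    rw [CumOrd.kappa, CumOrd.kappa_closed_form hi0 hi, hE]
  have hvar : ProbabilityTheory.variance (fun ω => g (X ω)) P =
      ∑' j, CumOrd.pmf P X j * g j ^ 2 - (∑' j, CumOrd.pmf P X j * g j) ^ 2 := by
    rw [ProbabilityTheory.variance_eq_sub hL2, ← CumOrd.integral_comp_eq_tsum hm g,
      ← CumOrd.integral_comp_eq_tsum hm fun j => g j ^ 2]
    rfl
  have hS : CumOrd.boundS P X δ β γ m n g =
      ∑ i ∈ Finset.Icc 1 m,
        (∏ l ∈ Finset.range n, (CumOrd.gap δ (m + l + 1) i / CumOrd.gap δ (m + l + 1) 0)) /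
          ((∏ r ∈ Finset.range i, CumOrd.gap δ i r) *
            ∑' j, CumOrd.wt (CumOrd.pmf P X) δ β γ i j) *
          (∑' j, CumOrd.wt (CumOrd.pmf P X) δ β γ i j * CumOrd.diff i g j) ^ 2 +
        ∑ i ∈ Finset.Icc 1 n, (-1 : ℝ) ^ (i - 1) * CumOrd.nu δ m n i *
          ∑' j, CumOrd.wt (CumOrd.pmf P X) δ β γ i j * CumOrd.diff i g j ^ 2 := by
    rw [CumOrd.boundS]
    congr 1
    · refine Finset.sum_congr rfl fun i hi => ?_
      have hi := Finset.mem_Icc.1 hi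
      rw [hkappa i hi.1 hi.2, hval]
    · refine Finset.sum_congr rfl fun i _ => ?_
      rw [hval i fun j => CumOrd.diff i g j ^ 2]
  have hrem := h.hasSum_remainder (CumOrd.tsum_pmf hm) hn hN hgn
  rw [← hvar, ← hS] at hrem
  have hsign := CumOrd.hasSum_sign (s := (-1 : ℝ) ^ n) hrem
    (fun k => by
      rcases (h.tsum_wt_nonneg (k + (m + n + 1))).eq_or_lt with hk | hk
      · simp [← hk]
      · exact div_nonneg (sq_nonneg _) (mul_pos (h.prod_gap_pos hk) hk).le)
    (fun k hk => by
      refine h.remainder_factor_pos hN ?_ (by omega)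
      refine lt_of_le_of_ne (h.tsum_wt_nonneg _) fun h0 => hk ?_
      rw [← h0, mul_zero, div_zero])
  refine ⟨hL2, fun i _ => ⟨?_, ?_⟩, fun i hi => (hint i fun j => CumOrd.diff i g j ^ 2).2 (hgi i hi),
    fun i hi0 hi => ?_, fun i hi0 hi => h.nu_pos hN hi0 hi, hsign.1, ?_⟩
  · simpa using (hint i fun _ => 1).2 (by simpa using h.summable_wt i)
  · have h1 := (h.mod_diff hmod i).summable
    rw [zero_add] at h1
    exact (hint i _).2 h1
  · rw [hkappa i hi0 hi]
    exact h.kappa_factor_pos hN hi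
  · rw [eq_comm, ← sub_eq_zero, hsign.2]
    refine Iff.trans ⟨fun h0 k hk => ?_, fun h0 k => ?_⟩ (h.forall_tsum_diff_eq_zero_iff hN hg0)
    · obtain ⟨l, rfl⟩ := Nat.exists_eq_add_of_lt hk
      have h1 := h0 l
      rw [show l + (m + n + 1) = m + n + l + 1 by ring] at h1
      by_cases hE' : 0 < ∑' j, CumOrd.wt (CumOrd.pmf P X) δ β γ (m + n + l + 1) j
      · rcases div_eq_zero_iff.1 h1 with h2 | h2
        · exact pow_eq_zero_iff (two_ne_zero) |>.1 h2
        · exact absurd h2 (mul_pos (h.prod_gap_pos hE') hE').ne'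
      · simp [h.wt_eq_zero hE']
    · rw [h0 _ (by omega)]
      simp
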